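/- Let $n\ge 2$, $a\in(-1,0)$ and $s=\frac{1-a}{2}$. Write points of $\mathbb{R}^{n+1}$ as $X=(x',x_n,y)$ with $x'\in\mathbb{R}^{n-1}$ and $x_n,y\in\mathbb{R}$, and let $L_a u=\operatorname{div}(|y|^a\nabla u)$. There is a constant $c=c_{n,a}>0$, depending only on $n$ and $a$, such that the following holds for every continuous $v:\mathbb{R}^{n-1}\to\mathbb{R}$ that vanishes at infinity. (1) There is exactly one continuous function $\bar v:\mathbb{R}^{n+1}\to\mathbb{R}$ with $\bar v(x',0,0)=v(x')$ for all $x'\in\mathbb{R}^{n-1}$ and $\bar v(X)\to0$ as $|X|\to\infty$ that is a weak solution of $L_a\bar v=0$ in $\Omega=\mathbb{R}^{n+1}\setminus\{x_n=y=0\}$, i.e. $\bar v\in W^{1,2}_{\rm loc}(\Omega,|y|^a)$ and $\int|y|^a\nabla\bar v\cdot\nabla\varphi\,dX=0$ for all $\varphi\in C_c^\infty(\Omega)$. (2) Define $$\mathcal{I}_a(v)(x')=\lim_{\varepsilon\downarrow0}\int_{\partial D_\varepsilon}\bar v_\nu(x',x_n,y)\,|y|^a\,d\sigma(x_n,y),$$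 where $D_\varepsilon\subset\mathbb{R}^2$ is the disc of radius $\varepsilon$ centered at the origin and $\nu=(0,x_n/\varepsilon,y/\varepsilon)$ is the normal pointing out of $D_\varepsilon$. At every $x'\in\mathbb{R}^{n-1}$ where the integral $$(-\Delta)^{\sigma}v(x')=\frac{4^{\sigma}\,\Gamma(\frac{n-1}{2}+\sigma)}{\pi^{\frac{n-1}{2}}\,|\Gamma(-\sigma)|}\int_{\mathbb{R}^{n-1}}\frac{v(x')-v(z')}{|x'-z'|^{n-1+2\sigma}}\,dz',\qquad \sigma=-\tfrac a2=s-\tfrac12\in(0,\tfrac12),$$ converges absolutely (for instance, wherever $v$ is Lipschitz near $x'$), $\bar v$ is differentiable on the circles $\{x'\}\times\partial D_\varepsilon$ for all small $\varepsilon>0$, the flux integrals over them converge, the limit $\mathcal{I}_a(v)(x')$ exists, and $$\mathcal{I}_a(v)(x')=-c_{n,a}\,(-\Delta)^{-\frac a2}v(x')=-c_{n,a}\,(-\Delta)^{s-\frac12}v(x').$$ -/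

import Mathlib

open MeasureTheory Filter Topology Set

open scoped ContDiff

noncomputable section

namespace VeryThin

/-- `ℝ^d × ℝ × ℝ`, whose points are `X = (x', x_n, y)`; with `d = n - 1` it is `ℝ^{n+1}`.
Its topology and its volume are those of `ℝ^{d+2}`. The Euclidean inner product is `dot` below. -/
abbrev Space (d : ℕ) : Type := EuclideanSpace ℝ (Fin d) × ℝ × ℝ

/-- The Euclidean inner product of `ℝ^{d+2}`. -/
def dot {d : ℕ} (P Q : Space d) : ℝ :=
  inner ℝ P.1 Q.1 + P.2.1 * Q.2.1 + P.2.2 * Q.2.2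

/-- The codimension-two set `{x_n = y = 0}`. -/
def thinSet (d : ℕ) : Set (Space d) := {X | X.2.1 = 0 ∧ X.2.2 = 0}

/-- `φ ∈ C_c^∞(Ω)`. -/
def IsTest {d : ℕ} (Ω : Set (Space d)) (φ : Space d → ℝ) : Prop :=
  ContDiff ℝ ∞ φ ∧ HasCompactSupport φ ∧ tsupport φ ⊆ Ω

/-- `G` is the weak (distributional) gradient of `u` in `Ω`. -/
def IsWeakGradient {d : ℕ} (Ω : Set (Space d)) (u : Space d → ℝ) (G : Space d → Space d) : Prop :=
  LocallyIntegrableOn u Ω ∧ LocallyIntegrableOn G Ω ∧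
  ∀ φ : Space d → ℝ, IsTest Ω φ → ∀ e : Space d,
    ∫ X, u X * fderiv ℝ φ X e = - ∫ X, dot (G X) e * φ X

/-- `u` is a weak solution of `L_a u = div (|y|^a ∇u) = 0` in `Ω`: `u ∈ W^{1,2}_loc(Ω, |y|^a)`
and `∫ |y|^a ∇u · ∇φ = 0` for all `φ ∈ C_c^∞(Ω)`. The derivative of `φ` at `X` in the direction
of the vector `G X = ∇u(X)` is `∇u(X) · ∇φ(X)`. -/
def IsAHarmonicOn {d : ℕ} (a : ℝ) (Ω : Set (Space d)) (u : Space d → ℝ) : Prop :=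
  ∃ G : Space d → Space d, IsWeakGradient Ω u G ∧
    LocallyIntegrableOn (fun X => |X.2.2| ^ a * u X ^ 2) Ω ∧
    LocallyIntegrableOn (fun X => |X.2.2| ^ a * dot (G X) (G X)) Ω ∧
    ∀ φ : Space d → ℝ, IsTest Ω φ → ∫ X, |X.2.2| ^ a * fderiv ℝ φ X (G X) = 0

/-- `V` is an `a`-harmonic extension of `v : ℝ^d → ℝ` to `ℝ^{d+2}` that vanishes at infinity. -/
structure IsAHarmonicExtension {d : ℕ} (a : ℝ) (v : EuclideanSpace ℝ (Fin d) → ℝ)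
    (V : Space d → ℝ) : Prop where
  continuous : Continuous V
  harmonic : IsAHarmonicOn a (thinSet d)ᶜ V
  trace : ∀ x' : EuclideanSpace ℝ (Fin d), V (x', 0, 0) = v x'
  decay : Tendsto V (cocompact (Space d)) (𝓝 0)

/-- The point `(x', ε cos θ, ε sin θ)` of the circle `{x'} × ∂D_ε`. -/
def circlePoint {d : ℕ} (x' : EuclideanSpace ℝ (Fin d)) (ε θ : ℝ) : Space d :=
  (x', ε * Real.cos θ, ε * Real.sin θ)

/-- The integrand, in the angle `θ`, of `∫_{∂D_ε} u_ν |y|^a dσ(x_n, y)`: here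
`ν = (0, cos θ, sin θ)` is the unit normal pointing out of `D_ε`, and `dσ = ε dθ`. -/
def fluxIntegrand {d : ℕ} (a : ℝ) (u : Space d → ℝ) (x' : EuclideanSpace ℝ (Fin d))
    (ε θ : ℝ) : ℝ :=
  fderiv ℝ u (circlePoint x' ε θ) (0, Real.cos θ, Real.sin θ) * |ε * Real.sin θ| ^ a * ε

/-- `ℱ_a(u)(x') = L`, that is, `lim_{ε ↓ 0} ∫_{∂D_ε} u_ν(x', x_n, y) |y|^a dσ(x_n, y) = L`, where
`u_ν` exists on the small circles and the integrals converge. -/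
def HasFlux {d : ℕ} (a : ℝ) (u : Space d → ℝ) (x' : EuclideanSpace ℝ (Fin d)) (L : ℝ) : Prop :=
  (∀ᶠ ε in 𝓝[>] (0 : ℝ),
    (∀ θ : ℝ, DifferentiableAt ℝ u (circlePoint x' ε θ)) ∧
    IntervalIntegrable (fluxIntegrand a u x' ε) volume 0 (2 * Real.pi)) ∧
  Tendsto (fun ε : ℝ => ∫ θ in (0 : ℝ)..(2 * Real.pi), fluxIntegrand a u x' ε θ)
    (𝓝[>] (0 : ℝ)) (𝓝 L)

/-- The integrand of the singular integral that defines `(-Δ)^σ v(x)`. -/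
def fracIntegrand {d : ℕ} (σ : ℝ) (v : EuclideanSpace ℝ (Fin d) → ℝ)
    (x z : EuclideanSpace ℝ (Fin d)) : ℝ :=
  (v x - v z) / ‖x - z‖ ^ ((d : ℝ) + 2 * σ)

/-- The fractional Laplacian `(-Δ)^σ v(x) = C_{d,σ} ∫ (v(x) - v(z)) / |x - z|^{d + 2σ} dz` with the
usual constant `C_{d,σ} = 4^σ Γ(d/2 + σ) / (π^{d/2} |Γ(-σ)|)`, at points where the integral
converges absolutely. For `0 < σ < 1/2` and bounded continuous `v` this holds wherever `v` is
locally Lipschitz, so that no principal value is needed. -/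
def fracLaplacian {d : ℕ} (σ : ℝ) (v : EuclideanSpace ℝ (Fin d) → ℝ)
    (x : EuclideanSpace ℝ (Fin d)) : ℝ :=
  4 ^ σ * Real.Gamma ((d : ℝ) / 2 + σ) / (Real.pi ^ ((d : ℝ) / 2) * |Real.Gamma (-σ)|) *
    ∫ z, fracIntegrand σ v x z

end VeryThin

end

noncomputable section

namespace VeryThin

variable {d : ℕ} {a : ℝ}

open scoped Convolution

/-! Write d = n - 1 and r² = x_n² + y². For a function that depends on (x_n, y) only through r, the
equation L_a u = 0 reads Δ_{x'} u + u_rr + ((1 + a)/r) u_r = 0, which is the Caffarelli–Silvestre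
equation with exponent 1 + a ∈ (0, 1). The extension is therefore explicit, with kernel r^{-a} (|x'
- z|² + r²)^{-(d-a)/2}, and its conormal derivative at r = 0 is a multiple of (-Δ)^{-a/2}.

Existence: the kernel solves ΔK + (a/y) ∂_y K = 0 pointwise off the thin set
(`laplacian_kernel_eq`). Integration by parts against the smooth weight (y² + δ)^{a/2}, followed by
δ → 0, makes it a weak solution (`integral_weight_mul_fderiv_gradKernel`), and Fubini passes this to
`poissonExt`. Continuity at the thin set and decay at infinity come from the scaled and unscaled
forms of Poisson's formula.

Uniqueness: the difference W of two extensions vanishes on the thin set and at infinity, so {W ≥ ε}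
is compact in Ω and a cutoff of W is an admissible test function up to smoothness. Mollification
supplies the smoothness; mollified gradients converge in L²(|y|^a) because |y|^a is an A_1 weight.
The energy of the cutoff tends to zero and a Poincaré inequality contradicts W > 0
(`IsWeakSolutionPair.nonpos`).

Flux: the extension of 1 is 1, so the kernel of r^{1+a} ∂_r has integral zero and v(z) may be
replaced by v(z) - v(x'). As r → 0 this kernel tends to -a |x' - z|^{-(d-a)} and is dominated by a
multiple of it, so dominated convergence gives the singular integral
(`tendsto_integral_fluxKernel`). The angle contributes only the factor ∫ |sin θ|^a dθ. -/

instance instIsAddHaarMeasureSpace : (volume : Measure (Space d)).IsAddHaarMeasure := by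
  have : (volume : Measure (ℝ × ℝ)).IsAddHaarMeasure :=
    Measure.prod.instIsAddHaarMeasure (volume : Measure ℝ) (volume : Measure ℝ)
  exact Measure.prod.instIsAddHaarMeasure (volume : Measure (EuclideanSpace ℝ (Fin d)))
    (volume : Measure (ℝ × ℝ))

/-! ### The weight |y|^a and its A_1 property -/

theorem lintegral_abs_rpow_closedBall_zero (ha : -1 < a) {R : ℝ} (hR : 0 ≤ R) :
    ∫⁻ t in Metric.closedBall (0 : ℝ) R, ENNReal.ofReal (|t| ^ a)
      ≤ ENNReal.ofReal (2 * (R ^ (a + 1) / (a + 1))) := by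
  have hpos : ∫⁻ t in Ioc (0 : ℝ) R, ENNReal.ofReal (|t| ^ a)
      = ENNReal.ofReal (R ^ (a + 1) / (a + 1)) := by
    have h1 : IntervalIntegrable (fun x : ℝ => x ^ a) volume 0 R :=
      intervalIntegral.intervalIntegrable_rpow' ha
    have h2 := integral_rpow (a := 0) (b := R) (Or.inl ha)
    rw [Real.zero_rpow (by linarith), sub_zero, intervalIntegral.integral_of_le hR] at h2
    rw [← h2, ofReal_integral_eq_lintegral_ofReal]
    · refine setLIntegral_congr_fun measurableSet_Ioc fun t ht => ?_
      simp only [abs_of_pos ht.1]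
    · exact (intervalIntegrable_iff_integrableOn_Ioc_of_le hR).1 h1
    · exact (ae_restrict_iff' measurableSet_Ioc).2
        (Eventually.of_forall fun t ht => Real.rpow_nonneg ht.1.le _)
  have hneg : ∫⁻ t in Ico (-R) 0, ENNReal.ofReal (|t| ^ a)
      = ∫⁻ t in Ioc (0 : ℝ) R, ENNReal.ofReal (|t| ^ a) := by
    have := (Measure.measurePreserving_neg (volume : Measure ℝ)).setLIntegral_comp_preimage_emb
      (MeasurableEquiv.neg ℝ).measurableEmbedding (fun t => ENNReal.ofReal (|t| ^ a)) (Ioc 0 R)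
    rw [← this]
    simp
  have hsub : Metric.closedBall (0 : ℝ) R ⊆ (Ico (-R) 0 ∪ {0}) ∪ Ioc 0 R := by
    intro t ht
    rw [Real.closedBall_eq_Icc] at ht
    simp only [zero_sub, zero_add, mem_Icc] at ht
    rcases lt_trichotomy t 0 with h | h | h
    · exact Or.inl (Or.inl ⟨ht.1, h⟩)
    · exact Or.inl (Or.inr h)
    · exact Or.inr ⟨h, ht.2⟩
  have ha' : 0 < a + 1 := by linarith
  refine (lintegral_mono_set hsub).trans ((lintegral_union_le _ _ _).trans
    ((add_le_add (lintegral_union_le _ _ _) le_rfl).trans ?_))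
  rw [hneg, hpos, Measure.restrict_singleton]
  simp only [Real.volume_singleton, zero_smul, lintegral_zero_measure, add_zero]
  rw [← ENNReal.ofReal_add (by positivity) (by positivity), two_mul]

/-- `|t|^a` is a Muckenhoupt `A_1` weight on the line for `-1 < a < 0`. -/
theorem exists_lintegral_abs_rpow_closedBall_le (ha : a ∈ Ioo (-1 : ℝ) 0) :
    ∃ C : ℝ, 0 ≤ C ∧ ∀ y : ℝ, y ≠ 0 → ∀ δ : ℝ, 0 < δ →
      ∫⁻ t in Metric.closedBall y δ, ENNReal.ofReal (|t| ^ a)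
        ≤ ENNReal.ofReal (C * δ * |y| ^ a) := by
  obtain ⟨ha1, ha0⟩ := ha
  have ha1' : 0 < a + 1 := by linarith
  -- The two summands serve two cases. If 2δ ≤ |y|, then |t| ≥ |y|/2 on the ball. If 2δ > |y|, the
  -- ball lies in [-3δ, 3δ] and δ^a ≤ (|y|/2)^a because a < 0.
  refine ⟨2 * 2⁻¹ ^ a + 2 * (3 ^ (a + 1) / (a + 1)) * 2⁻¹ ^ a, by positivity, fun y hy δ hδ => ?_⟩
  have hy0 : 0 < |y| := abs_pos.2 hy
  have hhalf : (|y| / 2) ^ a = 2⁻¹ ^ a * |y| ^ a := by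
    rw [div_eq_inv_mul, Real.mul_rpow (by norm_num) hy0.le]
  rcases le_or_gt (2 * δ) |y| with h | h
  · have h1 : ∀ t ∈ Metric.closedBall y δ, ENNReal.ofReal (|t| ^ a)
        ≤ ENNReal.ofReal (2⁻¹ ^ a * |y| ^ a) := by
      intro t ht
      rw [← hhalf]
      refine ENNReal.ofReal_le_ofReal
        (Real.rpow_le_rpow_of_nonpos (by positivity) ?_ ha0.le)
      rw [Metric.mem_closedBall, Real.dist_eq] at ht
      have := abs_sub_abs_le_abs_sub y t
      rw [abs_sub_comm] at this
      linarith
    calc _ ≤ ∫⁻ t in Metric.closedBall y δ, ENNReal.ofReal (2⁻¹ ^ a * |y| ^ a) :=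
          setLIntegral_mono' measurableSet_closedBall h1
      _ = ENNReal.ofReal (2⁻¹ ^ a * |y| ^ a * (2 * δ)) := by
          rw [setLIntegral_const, Real.volume_closedBall, ← ENNReal.ofReal_mul (by positivity)]
      _ ≤ _ := by
          apply ENNReal.ofReal_le_ofReal
          have : 0 ≤ 2 * (3 ^ (a + 1) / (a + 1)) * 2⁻¹ ^ a * δ * |y| ^ a := by positivity
          linarith
  · have hsub : Metric.closedBall y δ ⊆ Metric.closedBall 0 (3 * δ) := by
      refine Metric.closedBall_subset_closedBall' ?_
      rw [Real.dist_eq, sub_zero]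
      linarith
    refine ((lintegral_mono_set hsub).trans
      (lintegral_abs_rpow_closedBall_zero ha1 (by positivity))).trans ?_
    apply ENNReal.ofReal_le_ofReal
    have h2 : δ ^ a ≤ 2⁻¹ ^ a * |y| ^ a := by
      rw [← hhalf]
      exact Real.rpow_le_rpow_of_nonpos (by positivity) (by linarith) ha0.le
    have h3 : (3 * δ) ^ (a + 1) = 3 ^ (a + 1) * (δ ^ a * δ) := by
      rw [Real.mul_rpow (by norm_num) hδ.le, Real.rpow_add_one hδ.ne']
    rw [h3]
    have h4 : 2 * (3 ^ (a + 1) * (δ ^ a * δ) / (a + 1))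
        = (2 * (3 ^ (a + 1) / (a + 1)) * δ) * δ ^ a := by ring
    rw [h4]
    have h5 : (2 * (3 ^ (a + 1) / (a + 1)) * δ) * δ ^ a
        ≤ (2 * (3 ^ (a + 1) / (a + 1)) * δ) * (2⁻¹ ^ a * |y| ^ a) := by gcongr
    have : 0 ≤ 2 * 2⁻¹ ^ a * δ * |y| ^ a := by positivity
    linarith

/-- The measure `|y|^a dX`. -/
def weightMeasure (d : ℕ) (a : ℝ) : Measure (Space d) :=
  volume.withDensity fun X => ENNReal.ofReal (|X.2.2| ^ a)

theorem measurable_weight : Measurable fun X : Space d => |X.2.2| ^ a := by fun_prop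

/-- By the convention `0 ^ a = 0` the weight vanishes on y = 0 instead of being infinite there, so
pointwise lower bounds for it are available only off this null set. -/
theorem ae_y_ne_zero : ∀ᵐ X : Space d, X.2.2 ≠ 0 := by
  have h : ∀ᵐ p : ℝ × ℝ, p.2 ≠ 0 := by
    have : ∀ᵐ t : ℝ, t ≠ 0 := by simp [ae_iff]
    exact (Measure.quasiMeasurePreserving_snd (μ := (volume : Measure ℝ))
      (ν := (volume : Measure ℝ))).ae this
  exact (Measure.quasiMeasurePreserving_snd (μ := (volume : Measure (EuclideanSpace ℝ (Fin d))))
    (ν := (volume : Measure (ℝ × ℝ)))).ae h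

/-- The doubling-type estimate behind the `A_1` property of `|y|^a` in `ℝ^{d+2}`. -/
theorem exists_lintegral_weight_closedBall_le (d : ℕ) (ha : a ∈ Ioo (-1 : ℝ) 0) :
    ∃ C : ℝ, 0 ≤ C ∧ ∀ X : Space d, X.2.2 ≠ 0 → ∀ δ : ℝ, 0 < δ →
      ∫⁻ Y in Metric.closedBall X δ, ENNReal.ofReal (|Y.2.2| ^ a)
        ≤ ENNReal.ofReal (C * |X.2.2| ^ a) * volume (Metric.closedBall X δ) := by
  obtain ⟨C, hC, h⟩ := exists_lintegral_abs_rpow_closedBall_le ha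
  refine ⟨C, hC, fun X hX δ hδ => ?_⟩
  obtain ⟨x, s, y⟩ := X
  -- The distance on `Space d` is the maximum over the factors, so balls are products and only the y
  -- factor sees the weight.
  have hvol : volume (Metric.closedBall ((x, s, y) : Space d) δ)
      = volume (Metric.closedBall x δ) * (volume (Metric.closedBall s δ)
        * volume (Metric.closedBall y δ)) := by
    rw [← closedBall_prod_same, ← closedBall_prod_same, Measure.volume_eq_prod,
      Measure.prod_prod, Measure.volume_eq_prod, Measure.prod_prod]
  have hint : ∫⁻ Y in Metric.closedBall ((x, s, y) : Space d) δ, ENNReal.ofReal (|Y.2.2| ^ a)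
      = volume (Metric.closedBall x δ) * (volume (Metric.closedBall s δ)
        * ∫⁻ t in Metric.closedBall y δ, ENNReal.ofReal (|t| ^ a)) := by
    rw [← closedBall_prod_same, ← closedBall_prod_same, Measure.volume_eq_prod,
      ← Measure.prod_restrict, Measure.volume_eq_prod, ← Measure.prod_restrict,
      lintegral_prod _ (by fun_prop)]
    simp only [lintegral_const, MeasurableSet.univ, Measure.restrict_apply, univ_inter]
    rw [lintegral_prod _ (by fun_prop)]
    simp only [lintegral_const, MeasurableSet.univ, Measure.restrict_apply, univ_inter]
    ring
  rw [hint, hvol]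
  have h1 := h y hX δ hδ
  calc _ ≤ volume (Metric.closedBall x δ) * (volume (Metric.closedBall s δ)
        * (ENNReal.ofReal (C * |y| ^ a) * volume (Metric.closedBall y δ))) := by
        gcongr
        refine h1.trans ?_
        rw [Real.volume_closedBall, ← ENNReal.ofReal_mul (by positivity)]
        apply ENNReal.ofReal_le_ofReal
        have : 0 ≤ C * |y| ^ a * δ := by positivity
        linarith
    _ = _ := by ring

theorem lintegral_weight_closedBall_lt_top (ha : a ∈ Ioo (-1 : ℝ) 0) (X : Space d) (δ : ℝ) :
    ∫⁻ Y in Metric.closedBall X δ, ENNReal.ofReal (|Y.2.2| ^ a) < ⊤ := by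
  obtain ⟨C, -, h⟩ := exists_lintegral_weight_closedBall_le d ha
  -- The centre X may lie on y = 0, where the A_1 bound says nothing; a larger ball centred at
  -- height y = 1 covers it.
  set Z : Space d := (0, 0, 1)
  have hsub : Metric.closedBall X δ ⊆ Metric.closedBall Z (|δ| + dist X Z + 1) :=
    Metric.closedBall_subset_closedBall' (by linarith [le_abs_self δ])
  refine (lintegral_mono_set hsub).trans_lt ((h Z (by simp [Z]) _ (by positivity)).trans_lt ?_)
  exact ENNReal.mul_lt_top ENNReal.ofReal_lt_top measure_closedBall_lt_top

theorem locallyIntegrable_weight (ha : a ∈ Ioo (-1 : ℝ) 0) :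
    LocallyIntegrable (fun X : Space d => |X.2.2| ^ a) := by
  intro X
  refine ⟨Metric.closedBall X 1, Metric.closedBall_mem_nhds X one_pos,
    measurable_weight.aestronglyMeasurable, ?_⟩
  rw [hasFiniteIntegral_iff_ofReal (Eventually.of_forall fun Y => by positivity)]
  exact lintegral_weight_closedBall_lt_top ha X 1

theorem isLocallyFiniteMeasure_weightMeasure (ha : a ∈ Ioo (-1 : ℝ) 0) :
    IsLocallyFiniteMeasure (weightMeasure d a) := by
  refine ⟨fun X => ⟨Metric.closedBall X 1, Metric.closedBall_mem_nhds X one_pos, ?_⟩⟩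
  rw [weightMeasure, withDensity_apply _ measurableSet_closedBall]
  exact lintegral_weight_closedBall_lt_top ha X 1

theorem weightMeasure_absolutelyContinuous : weightMeasure d a ≪ volume :=
  withDensity_absolutelyContinuous _ _

theorem lintegral_weightMeasure (f : Space d → ENNReal) :
    ∫⁻ X, f X ∂(weightMeasure d a) = ∫⁻ X, ENNReal.ofReal (|X.2.2| ^ a) * f X := by
  rw [weightMeasure, lintegral_withDensity_eq_lintegral_mul_non_measurable _
    (by fun_prop) (Eventually.of_forall fun X => ENNReal.ofReal_lt_top)]
  rfl

instance instIsNegInvariantSpace : (volume : Measure (Space d)).IsNegInvariant :=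
  Measure.IsAddHaarMeasure.isNegInvariant_of_regular _

/-! ### Mollification in L²(|y|^a) -/

/-- A bump function at the origin of `ℝ^{d+2}`, supported in the ball of radius `1 / (k + 1)`. -/
def shrinkingBump (d k : ℕ) : ContDiffBump (0 : Space d) where
  rIn := 1 / (2 * ((k : ℝ) + 1))
  rOut := 1 / ((k : ℝ) + 1)
  rIn_pos := by positivity
  rIn_lt_rOut := by
    apply one_div_lt_one_div_of_lt (by positivity)
    have : (0 : ℝ) < (k : ℝ) + 1 := by positivity
    linarith

theorem shrinkingBump_rOut (d k : ℕ) : (shrinkingBump d k).rOut = 1 / ((k : ℝ) + 1) := rfl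

/-- A ratio of radii that is the same for all k makes the bound in `mollifier_le` independent of k.
-/
theorem shrinkingBump_rOut_eq (d k : ℕ) :
    (shrinkingBump d k).rOut = 2 * (shrinkingBump d k).rIn := by
  simp only [shrinkingBump]
  field_simp

theorem tendsto_shrinkingBump_rOut (d : ℕ) :
    Tendsto (fun k => (shrinkingBump d k).rOut) atTop (𝓝 0) :=
  tendsto_one_div_add_atTop_nhds_zero_nat

/-- The standard nonnegative mollifiers of mass one. -/
def mollifier (d k : ℕ) : Space d → ℝ := (shrinkingBump d k).normed volume

/-- Mollification at scale `1 / (k + 1)`. -/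
def mollify {E : Type*} [NormedAddCommGroup E] [NormedSpace ℝ E] (k : ℕ) (f : Space d → E) :
    Space d → E :=
  mollifier d k ⋆[ContinuousLinearMap.lsmul ℝ ℝ, volume] f

theorem mollifier_nonneg (k : ℕ) (X : Space d) : 0 ≤ mollifier d k X :=
  (shrinkingBump d k).nonneg_normed X

theorem contDiff_mollifier (k : ℕ) : ContDiff ℝ ∞ (mollifier d k) :=
  (shrinkingBump d k).contDiff_normed

theorem integral_mollifier (k : ℕ) : ∫ X, mollifier d k X = 1 :=
  (shrinkingBump d k).integral_normed

theorem tsupport_mollifier (k : ℕ) :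
    tsupport (mollifier d k) = Metric.closedBall 0 (shrinkingBump d k).rOut :=
  (shrinkingBump d k).tsupport_normed_eq

theorem hasCompactSupport_mollifier (k : ℕ) : HasCompactSupport (mollifier d k) :=
  (shrinkingBump d k).hasCompactSupport_normed

theorem integrable_mollifier (k : ℕ) : Integrable (mollifier d k) :=
  (contDiff_mollifier k).continuous.integrable_of_hasCompactSupport (hasCompactSupport_mollifier k)

theorem lintegral_mollifier_sub (k : ℕ) (X : Space d) :
    ∫⁻ Y, ENNReal.ofReal (mollifier d k (X - Y)) = 1 := by
  rw [lintegral_sub_left_eq_self (fun Z : Space d => ENNReal.ofReal (mollifier d k Z)) X,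
    ← ofReal_integral_eq_lintegral_ofReal (integrable_mollifier k)
      (Eventually.of_forall (mollifier_nonneg k)), integral_mollifier, ENNReal.ofReal_one]

theorem mollify_apply {E : Type*} [NormedAddCommGroup E] [NormedSpace ℝ E] (k : ℕ)
    (f : Space d → E) (X : Space d) : mollify k f X = ∫ Y, mollifier d k (X - Y) • f Y := by
  rw [mollify, convolution_eq_swap]
  rfl

theorem mollifier_sub_eq_zero {k : ℕ} {X Y : Space d}
    (h : Y ∉ Metric.closedBall X (shrinkingBump d k).rOut) : mollifier d k (X - Y) = 0 := by
  apply image_eq_zero_of_notMem_tsupport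
  rwa [tsupport_mollifier, mem_closedBall_zero_iff, ← dist_eq_norm, dist_comm]

/-- A bump of mass one is at most the reciprocal volume of its inner ball, and the outer ball is
twice as large in every direction. -/
theorem mollifier_le (k : ℕ) (X Y : Space d) :
    ENNReal.ofReal (mollifier d k X) * volume (Metric.closedBall Y (shrinkingBump d k).rOut)
      ≤ 2 ^ Module.finrank ℝ (Space d) := by
  set b := shrinkingBump d k
  set N := Module.finrank ℝ (Space d)
  have hr := b.rIn_pos
  have h1 : mollifier d k X ≤ 1 / volume.real (Metric.closedBall (0 : Space d) b.rIn) :=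
    b.normed_le_div_measure_closedBall_rIn volume X
  have h2 : volume (Metric.closedBall Y b.rOut)
      = 2 ^ N * volume (Metric.closedBall (0 : Space d) b.rIn) := by
    rw [Measure.addHaar_closedBall _ _ hr.le, Measure.addHaar_closedBall _ _ b.rOut_pos.le,
      shrinkingBump_rOut_eq, mul_pow, ENNReal.ofReal_mul (by positivity), mul_assoc,
      ENNReal.ofReal_pow (by norm_num)]
    norm_num [N, b]
  have hv0 : volume (Metric.closedBall (0 : Space d) b.rIn) ≠ 0 :=
    (Metric.measure_closedBall_pos _ _ hr).ne'
  have hvt : volume (Metric.closedBall (0 : Space d) b.rIn) ≠ ⊤ :=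
    measure_closedBall_lt_top.ne
  have h3 : ENNReal.ofReal (mollifier d k X)
      ≤ (volume (Metric.closedBall (0 : Space d) b.rIn))⁻¹ := by
    refine (ENNReal.ofReal_le_ofReal h1).trans ?_
    rw [one_div, Measure.real, ENNReal.ofReal_inv_of_pos (ENNReal.toReal_pos hv0 hvt),
      ENNReal.ofReal_toReal hvt]
  rw [h2]
  calc _ ≤ (volume (Metric.closedBall (0 : Space d) b.rIn))⁻¹
        * (2 ^ N * volume (Metric.closedBall (0 : Space d) b.rIn)) := by gcongr
    _ = 2 ^ N * ((volume (Metric.closedBall (0 : Space d) b.rIn))⁻¹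
        * volume (Metric.closedBall (0 : Space d) b.rIn)) := by ring
    _ = 2 ^ N := by rw [ENNReal.inv_mul_cancel hv0 hvt, mul_one]

/-- Up to the factor of `mollifier_le`, mollifying the weight averages it over a ball, and A_1
bounds that average by the value at the centre. Once the order of integration is exchanged, it is
the weight that gets mollified. -/
theorem exists_lintegral_weight_mollifier_le (d : ℕ) (ha : a ∈ Ioo (-1 : ℝ) 0) :
    ∃ C : ENNReal, C ≠ ⊤ ∧ ∀ (k : ℕ) (Y : Space d), Y.2.2 ≠ 0 →
      ∫⁻ X, ENNReal.ofReal (|X.2.2| ^ a) * ENNReal.ofReal (mollifier d k (X - Y))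
        ≤ C * ENNReal.ofReal (|Y.2.2| ^ a) := by
  obtain ⟨C, hC, h⟩ := exists_lintegral_weight_closedBall_le d ha
  refine ⟨2 ^ Module.finrank ℝ (Space d) * ENNReal.ofReal C,
    ENNReal.mul_ne_top (by simp) (by simp), fun k Y hY => ?_⟩
  set r := (shrinkingBump d k).rOut
  have hr : 0 < r := (shrinkingBump d k).rOut_pos
  set v := volume (Metric.closedBall Y r)
  have hv0 : v ≠ 0 := (Metric.measure_closedBall_pos _ _ hr).ne'
  have hvt : v ≠ ⊤ := measure_closedBall_lt_top.ne
  have hle : ∀ X : Space d, ENNReal.ofReal (|X.2.2| ^ a) * ENNReal.ofReal (mollifier d k (X - Y))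
      ≤ (Metric.closedBall Y r).indicator
        (fun X => 2 ^ Module.finrank ℝ (Space d) * v⁻¹ * ENNReal.ofReal (|X.2.2| ^ a)) X := by
    intro X
    by_cases hX : X ∈ Metric.closedBall Y r
    · rw [indicator_of_mem hX, mul_comm]
      gcongr
      rw [← div_eq_mul_inv, ENNReal.le_div_iff_mul_le (Or.inl hv0) (Or.inl hvt)]
      exact mollifier_le k _ _
    · rw [mollifier_sub_eq_zero (by rwa [Metric.mem_closedBall_comm]), ENNReal.ofReal_zero,
        mul_zero]
      exact zero_le
  calc _ ≤ ∫⁻ X, (Metric.closedBall Y r).indicator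
        (fun X => 2 ^ Module.finrank ℝ (Space d) * v⁻¹ * ENNReal.ofReal (|X.2.2| ^ a)) X :=
        lintegral_mono hle
    _ = 2 ^ Module.finrank ℝ (Space d) * v⁻¹
        * ∫⁻ X in Metric.closedBall Y r, ENNReal.ofReal (|X.2.2| ^ a) := by
        rw [lintegral_indicator measurableSet_closedBall, lintegral_const_mul _ (by fun_prop)]
    _ ≤ 2 ^ Module.finrank ℝ (Space d) * v⁻¹ * (ENNReal.ofReal (C * |Y.2.2| ^ a) * v) := by
        gcongr
        exact h Y hY r hr
    _ = 2 ^ Module.finrank ℝ (Space d) * ENNReal.ofReal (C * |Y.2.2| ^ a) * (v⁻¹ * v) := by ring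
    _ = _ := by
        rw [ENNReal.inv_mul_cancel hv0 hvt, mul_one, ENNReal.ofReal_mul hC, mul_assoc]

/-- Cauchy–Schwarz for the factors √p and √p h. -/
theorem lintegral_mul_sq_le {α : Type*} [MeasurableSpace α] {μ : Measure α} {p h : α → ENNReal}
    (hp : AEMeasurable p μ) (hh : AEMeasurable h μ) :
    (∫⁻ x, p x * h x ∂μ) ^ 2 ≤ (∫⁻ x, p x ∂μ) * ∫⁻ x, p x * h x ^ 2 ∂μ := by
  have key := ENNReal.lintegral_mul_norm_pow_le (μ := μ) (f := p) (g := fun x => p x * h x ^ 2)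
    hp (hp.mul (hh.pow_const 2)) (p := 1 / 2) (q := 1 / 2) (by norm_num) (by norm_num)
    (by norm_num)
  have hpt : ∀ x, p x ^ (1 / 2 : ℝ) * (p x * h x ^ 2) ^ (1 / 2 : ℝ) = p x * h x := by
    intro x
    rw [ENNReal.mul_rpow_of_nonneg _ _ (by norm_num), ← mul_assoc,
      ← ENNReal.rpow_add_of_nonneg _ _ (by norm_num) (by norm_num), ← ENNReal.rpow_natCast,
      ← ENNReal.rpow_mul]
    norm_num
  simp only [hpt] at key
  calc _ ≤ ((∫⁻ x, p x ∂μ) ^ (1 / 2 : ℝ) * (∫⁻ x, p x * h x ^ 2 ∂μ) ^ (1 / 2 : ℝ)) ^ 2 := by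
        gcongr
    _ = _ := by
        rw [mul_pow, ← ENNReal.rpow_natCast, ← ENNReal.rpow_natCast, ← ENNReal.rpow_mul,
          ← ENNReal.rpow_mul]
        norm_num

section

variable {E : Type*} [NormedAddCommGroup E] [NormedSpace ℝ E]

theorem enorm_mollify_sq_le (k : ℕ) {g : Space d → E} (hg : AEStronglyMeasurable g volume)
    (X : Space d) :
    ‖mollify k g X‖ₑ ^ 2 ≤ ∫⁻ Y, ENNReal.ofReal (mollifier d k (X - Y)) * ‖g Y‖ₑ ^ 2 := by
  have hm : AEMeasurable (fun Y => ENNReal.ofReal (mollifier d k (X - Y))) volume := by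
    have := (contDiff_mollifier (d := d) k).continuous
    exact Measurable.aemeasurable (by fun_prop)
  have h1 : ‖mollify k g X‖ₑ ≤ ∫⁻ Y, ENNReal.ofReal (mollifier d k (X - Y)) * ‖g Y‖ₑ := by
    rw [mollify_apply]
    refine (enorm_integral_le_lintegral_enorm _).trans (le_of_eq ?_)
    refine lintegral_congr fun Y => ?_
    rw [enorm_smul, Real.enorm_of_nonneg (mollifier_nonneg _ _)]
  calc _ ≤ (∫⁻ Y, ENNReal.ofReal (mollifier d k (X - Y)) * ‖g Y‖ₑ) ^ 2 := by gcongr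
    _ ≤ _ := (lintegral_mul_sq_le hm hg.enorm).trans (by rw [lintegral_mollifier_sub, one_mul])

/-- Pointwise Jensen, Tonelli, and the bound on the mollified weight. Uniformity in k is what the
density argument for convergence needs. -/
theorem exists_eLpNorm_mollify_le (d : ℕ) (ha : a ∈ Ioo (-1 : ℝ) 0) :
    ∃ C : ENNReal, C ≠ ⊤ ∧ ∀ (k : ℕ) (g : Space d → E), AEStronglyMeasurable g volume →
      eLpNorm (mollify k g) 2 (weightMeasure d a) ≤ C * eLpNorm g 2 (weightMeasure d a) := by
  obtain ⟨C, hC, h⟩ := exists_lintegral_weight_mollifier_le d ha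
  refine ⟨C ^ (1 / 2 : ℝ), ENNReal.rpow_ne_top_of_nonneg (by norm_num) hC, fun k g hg => ?_⟩
  have hcont := (contDiff_mollifier (d := d) k).continuous
  have key : ∫⁻ X, ‖mollify k g X‖ₑ ^ 2 ∂(weightMeasure d a)
      ≤ C * ∫⁻ X, ‖g X‖ₑ ^ 2 ∂(weightMeasure d a) := by
    rw [lintegral_weightMeasure, lintegral_weightMeasure]
    calc _ ≤ ∫⁻ X : Space d, ∫⁻ Y, ENNReal.ofReal (|X.2.2| ^ a)
          * (ENNReal.ofReal (mollifier d k (X - Y)) * ‖g Y‖ₑ ^ 2) := by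
          refine lintegral_mono fun X => ?_
          rw [lintegral_const_mul' _ _ ENNReal.ofReal_ne_top]
          gcongr
          exact enorm_mollify_sq_le k hg X
      _ = ∫⁻ Y : Space d, ∫⁻ X : Space d, ENNReal.ofReal (|X.2.2| ^ a)
          * (ENNReal.ofReal (mollifier d k (X - Y)) * ‖g Y‖ₑ ^ 2) := by
          refine lintegral_lintegral_swap ?_
          have h1 : AEMeasurable (fun p : Space d × Space d => ‖g p.2‖ₑ ^ 2)
              (volume.prod volume) := (hg.comp_snd.enorm).pow_const 2
          have h2 : Measurable fun p : Space d × Space d =>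
              ENNReal.ofReal (mollifier d k (p.1 - p.2)) := by fun_prop
          have h3 : Measurable fun p : Space d × Space d =>
              ENNReal.ofReal (|p.1.2.2| ^ a) := by fun_prop
          exact h3.aemeasurable.mul (h2.aemeasurable.mul h1)
      _ = ∫⁻ Y : Space d, (∫⁻ X : Space d, ENNReal.ofReal (|X.2.2| ^ a)
          * ENNReal.ofReal (mollifier d k (X - Y))) * ‖g Y‖ₑ ^ 2 := by
          refine lintegral_congr fun Y => ?_
          rw [← lintegral_mul_const _ (by fun_prop)]
          simp only [mul_assoc]
      _ ≤ ∫⁻ Y : Space d, C * (ENNReal.ofReal (|Y.2.2| ^ a) * ‖g Y‖ₑ ^ 2) := by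
          refine lintegral_mono_ae ?_
          filter_upwards [ae_y_ne_zero (d := d)] with Y hY
          rw [← mul_assoc]
          gcongr
          exact h k Y hY
      _ = _ := lintegral_const_mul' _ _ hC
  rw [eLpNorm_eq_lintegral_rpow_enorm_toReal (by norm_num) (by norm_num),
    eLpNorm_eq_lintegral_rpow_enorm_toReal (by norm_num) (by norm_num),
    ENNReal.toReal_ofNat, ← ENNReal.mul_rpow_of_nonneg _ _ (by norm_num)]
  simp only [ENNReal.rpow_ofNat]
  exact ENNReal.rpow_le_rpow key (by norm_num)

theorem continuous_mollify (k : ℕ) {g : Space d → E} (hg : LocallyIntegrable g) :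
    Continuous (mollify k g) :=
  (hasCompactSupport_mollifier k).continuous_convolution_left _
    (contDiff_mollifier k).continuous hg

theorem mollify_sub (k : ℕ) {f g : Space d → E} (hf : LocallyIntegrable f)
    (hg : LocallyIntegrable g) : mollify k (f - g) = mollify k f - mollify k g := by
  ext1 X
  have hi : ∀ {h : Space d → E}, LocallyIntegrable h →
      Integrable fun Y => mollifier d k (X - Y) • h Y := by
    intro h hh
    refine hh.integrable_smul_left_of_hasCompactSupport
      ((contDiff_mollifier k).continuous.comp (continuous_const.sub continuous_id)) ?_
    exact (hasCompactSupport_mollifier k).comp_homeomorph (Homeomorph.subLeft X)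
  simp only [Pi.sub_apply, mollify_apply, smul_sub]
  exact integral_sub (hi hf) (hi hg)

theorem dist_mollify_le [CompleteSpace E] (k : ℕ) {g : Space d → E}
    (hg : AEStronglyMeasurable g volume) {X : Space d} {ε : ℝ}
    (h : ∀ Y ∈ Metric.ball X (shrinkingBump d k).rOut, dist (g Y) (g X) ≤ ε) :
    dist (mollify k g X) (g X) ≤ ε :=
  ContDiffBump.dist_normed_convolution_le hg h

theorem mollify_eq_zero (k : ℕ) {g : Space d → E} {X : Space d}
    (h : ∀ Y ∈ Metric.closedBall X (shrinkingBump d k).rOut, g Y = 0) : mollify k g X = 0 := by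
  rw [mollify_apply]
  refine integral_eq_zero_of_ae (Eventually.of_forall fun Y => ?_)
  by_cases hY : Y ∈ Metric.closedBall X (shrinkingBump d k).rOut
  · simp [h Y hY]
  · simp [mollifier_sub_eq_zero hY]

/-- All mollifications live in one compact set, which has finite weighted measure, so uniform
convergence from uniform continuity suffices. -/
theorem tendsto_eLpNorm_mollify_sub_of_continuous [CompleteSpace E] (ha : a ∈ Ioo (-1 : ℝ) 0)
    {g : Space d → E} (hg : Continuous g) (hc : HasCompactSupport g) :
    Tendsto (fun k => eLpNorm (mollify k g - g) 2 (weightMeasure d a)) atTop (𝓝 0) := by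
  have := isLocallyFiniteMeasure_weightMeasure (d := d) ha
  set K := Metric.cthickening 1 (tsupport g)
  have hK : IsCompact K := hc.isCompact.cthickening
  have hsupp : ∀ k, ∀ X ∉ K, (mollify k g - g) X = 0 := by
    intro k X hX
    have h0 : ∀ Y ∈ Metric.closedBall X (shrinkingBump d k).rOut, g Y = 0 := by
      intro Y hY
      by_contra hne
      refine hX (Metric.mem_cthickening_of_dist_le X Y 1 _ (subset_tsupport _ hne) ?_)
      rw [dist_comm]
      refine (Metric.mem_closedBall.1 hY).trans ?_
      rw [shrinkingBump_rOut, div_le_one (by positivity)]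
      linarith [(Nat.cast_nonneg k : (0 : ℝ) ≤ k)]
    rw [Pi.sub_apply, mollify_eq_zero k h0,
      h0 X (Metric.mem_closedBall_self (shrinkingBump d k).rOut_pos.le), sub_zero]
  have hμK : weightMeasure d a K ≠ ⊤ := hK.measure_lt_top.ne
  rw [ENNReal.tendsto_nhds_zero]
  intro η hη
  obtain ⟨ε, hε, hεη⟩ : ∃ ε : ℝ, 0 < ε ∧
      weightMeasure d a K ^ (2 : ENNReal).toReal⁻¹ * ENNReal.ofReal ε ≤ η := by
    set M := weightMeasure d a K ^ (2 : ENNReal).toReal⁻¹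
    have hM : M ≠ ⊤ := ENNReal.rpow_ne_top_of_nonneg (by norm_num) hμK
    have ht : Tendsto (fun ε : ℝ => M * ENNReal.ofReal ε) (𝓝[>] 0) (𝓝 0) := by
      have : Tendsto (fun ε : ℝ => M * ENNReal.ofReal ε) (𝓝 0) (𝓝 (M * ENNReal.ofReal 0)) :=
        ENNReal.Tendsto.const_mul (ENNReal.tendsto_ofReal tendsto_id) (Or.inr hM)
      rw [ENNReal.ofReal_zero, mul_zero] at this
      exact this.mono_left nhdsWithin_le_nhds
    obtain ⟨ε, h1, h2⟩ := ((ENNReal.tendsto_nhds_zero.1 ht η hη).and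
      self_mem_nhdsWithin).exists
    exact ⟨ε, h2, h1⟩
  obtain ⟨δ, hδ, hu⟩ := Metric.uniformContinuous_iff.1 (hc.uniformContinuous_of_continuous hg) ε hε
  filter_upwards [(tendsto_shrinkingBump_rOut d).eventually (gt_mem_nhds hδ)] with k hk
  have hres : eLpNorm (mollify k g - g) 2 (weightMeasure d a)
      = eLpNorm (mollify k g - g) 2 ((weightMeasure d a).restrict K) := by
    rw [← eLpNorm_indicator_eq_eLpNorm_restrict hK.measurableSet]
    congr 1
    ext1 X
    by_cases hX : X ∈ K
    · rw [indicator_of_mem hX]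
    · rw [indicator_of_notMem hX, hsupp k X hX]
  rw [hres]
  refine (eLpNorm_le_of_ae_bound (C := ε) (Eventually.of_forall fun X => ?_)).trans ?_
  · rw [Pi.sub_apply, ← dist_eq_norm]
    exact dist_mollify_le k hg.aestronglyMeasurable fun Y hY =>
      (hu (lt_trans (Metric.mem_ball.1 hY) hk)).le
  · rwa [Measure.restrict_apply_univ]

/-- Continuous functions with compact support are dense in L² of the weighted measure, and the
mollifications are uniformly bounded there: the three terms of the splitting cost C η', η' and η'.
-/
theorem tendsto_eLpNorm_mollify_sub [CompleteSpace E] (ha : a ∈ Ioo (-1 : ℝ) 0)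
    {g : Space d → E} (hg : LocallyIntegrable g) (h2 : MemLp g 2 (weightMeasure d a)) :
    Tendsto (fun k => eLpNorm (mollify k g - g) 2 (weightMeasure d a)) atTop (𝓝 0) := by
  have := isLocallyFiniteMeasure_weightMeasure (d := d) ha
  obtain ⟨C, hC, hbd⟩ := exists_eLpNorm_mollify_le (E := E) d ha
  rw [ENNReal.tendsto_nhds_zero]
  intro η hη
  obtain ⟨η', hη', hle⟩ : ∃ η' : ENNReal, η' ≠ 0 ∧ C * η' + η' + η' ≤ η := by
    have ht : Tendsto (fun t : ENNReal => C * t + t + t) (𝓝[>] 0) (𝓝 0) := by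
      have h1 : Tendsto (fun t : ENNReal => C * t + t + t) (𝓝 0) (𝓝 (C * 0 + 0 + 0)) :=
        ((ENNReal.Tendsto.const_mul tendsto_id (Or.inr hC)).add tendsto_id).add tendsto_id
      rw [mul_zero, add_zero, add_zero] at h1
      exact h1.mono_left nhdsWithin_le_nhds
    obtain ⟨t, h1, h2⟩ := ((ENNReal.tendsto_nhds_zero.1 ht η hη).and
      self_mem_nhdsWithin).exists
    exact ⟨t, (show 0 < t from h2).ne', h1⟩
  obtain ⟨f, hfc, hfg, hf, hfL⟩ := h2.exists_hasCompactSupport_eLpNorm_sub_le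
    (by norm_num) hη'
  filter_upwards [(ENNReal.tendsto_nhds_zero.1
    (tendsto_eLpNorm_mollify_sub_of_continuous ha hf hfc)) η' (pos_iff_ne_zero.2 hη')] with k hk
  have hfl : LocallyIntegrable f := hf.locallyIntegrable
  have heq : mollify k g - g = (mollify k (g - f) + (mollify k f - f)) + (f - g) := by
    rw [mollify_sub k hg hfl]
    abel
  have m1 : AEStronglyMeasurable (mollify k (g - f)) (weightMeasure d a) :=
    (continuous_mollify k (hg.sub hfl)).aestronglyMeasurable
  have m2 : AEStronglyMeasurable (mollify k f - f) (weightMeasure d a) :=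
    ((continuous_mollify k hfl).sub hf).aestronglyMeasurable
  have m3 : AEStronglyMeasurable (f - g) (weightMeasure d a) := hfL.1.sub h2.1
  rw [heq]
  refine (eLpNorm_add_le (m1.add m2) m3 (by norm_num)).trans ?_
  refine le_trans ?_ hle
  gcongr
  · refine (eLpNorm_add_le m1 m2 (by norm_num)).trans ?_
    gcongr
    exact (hbd k _ (hg.sub hfl).aestronglyMeasurable).trans (by gcongr)
  · rwa [eLpNorm_sub_comm]

end

/-! ### The Euclidean form and weak solutions as a linear class -/

/-- `dot · e` as a continuous linear functional. -/
def dotCLM (e : Space d) : Space d →L[ℝ] ℝ :=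
  (innerSL ℝ e.1).comp (ContinuousLinearMap.fst ℝ _ _)
    + (e.2.1 • (ContinuousLinearMap.fst ℝ ℝ ℝ)
      + e.2.2 • (ContinuousLinearMap.snd ℝ ℝ ℝ)).comp (ContinuousLinearMap.snd ℝ _ _)

theorem dotCLM_apply (P e : Space d) : dotCLM e P = dot P e := by
  simp only [dotCLM, dot, add_apply, ContinuousLinearMap.comp_apply,
    ContinuousLinearMap.coe_fst', ContinuousLinearMap.coe_snd', innerSL_apply_apply,
    smul_apply, smul_eq_mul, real_inner_comm]
  ring

theorem dot_comm (P Q : Space d) : dot P Q = dot Q P := by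
  simp only [dot, real_inner_comm]
  ring

theorem dot_sub_left (P Q e : Space d) : dot (P - Q) e = dot P e - dot Q e := by
  simp only [← dotCLM_apply, map_sub]

theorem dot_sub_right (P Q e : Space d) : dot e (P - Q) = dot e P - dot e Q := by
  rw [dot_comm, dot_sub_left, dot_comm P, dot_comm Q]

/-- The norm of `Space d` is a maximum, not the Euclidean norm; this and `abs_dot_le` convert
between the two. -/
theorem norm_sq_le_dot (P : Space d) : ‖P‖ ^ 2 ≤ dot P P := by
  obtain ⟨x, s, y⟩ := P
  simp only [dot, Prod.norm_def, real_inner_self_eq_norm_sq]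
  have h1 := sq_nonneg ‖x‖
  have h2 := mul_self_nonneg s
  have h3 := mul_self_nonneg y
  rcases max_choice ‖x‖ (max ‖s‖ ‖y‖) with h | h
  · rw [h]; linarith
  · rw [h]
    rcases max_choice ‖s‖ ‖y‖ with h | h
    · rw [h, Real.norm_eq_abs, sq_abs]; nlinarith
    · rw [h, Real.norm_eq_abs, sq_abs]; nlinarith

theorem dot_self_nonneg (P : Space d) : 0 ≤ dot P P :=
  (sq_nonneg _).trans (norm_sq_le_dot P)

theorem abs_dot_le (P Q : Space d) : |dot P Q| ≤ 3 * (‖P‖ * ‖Q‖) := by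
  have h1 : |inner ℝ P.1 Q.1| ≤ ‖P‖ * ‖Q‖ :=
    (abs_real_inner_le_norm _ _).trans (by gcongr <;> exact norm_fst_le _)
  have h2 : |P.2.1 * Q.2.1| ≤ ‖P‖ * ‖Q‖ := by
    rw [abs_mul]
    exact mul_le_mul ((norm_fst_le P.2).trans (norm_snd_le P))
      ((norm_fst_le Q.2).trans (norm_snd_le Q)) (abs_nonneg _) (norm_nonneg _)
  have h3 : |P.2.2 * Q.2.2| ≤ ‖P‖ * ‖Q‖ := by
    rw [abs_mul]
    exact mul_le_mul ((norm_snd_le P.2).trans (norm_snd_le P))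
      ((norm_snd_le Q.2).trans (norm_snd_le Q)) (abs_nonneg _) (norm_nonneg _)
  have := abs_add_three (inner ℝ P.1 Q.1) (P.2.1 * Q.2.1) (P.2.2 * Q.2.2)
  simp only [dot]
  linarith

theorem dot_self_le (P : Space d) : dot P P ≤ 3 * ‖P‖ ^ 2 := by
  rw [pow_two]
  exact (le_abs_self _).trans (abs_dot_le P P)

/-- Young's inequality for the positive semidefinite form `dot`. -/
theorem two_mul_dot_le (P Q : Space d) : 2 * dot P Q ≤ dot P P + dot Q Q := by
  have h := dot_self_nonneg (P - Q)
  rw [dot_sub_left, dot_sub_right, dot_sub_right, dot_comm Q P] at h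
  linarith

theorem continuous_dot : Continuous fun p : Space d × Space d => dot p.1 p.2 := by
  unfold dot
  fun_prop

theorem integral_weightMeasure {E : Type*} [NormedAddCommGroup E] [NormedSpace ℝ E]
    (f : Space d → E) :
    ∫ X, f X ∂(weightMeasure d a) = ∫ X, |X.2.2| ^ a • f X := by
  rw [weightMeasure, integral_withDensity_eq_integral_toReal_smul (by fun_prop)
    (Eventually.of_forall fun X => ENNReal.ofReal_lt_top)]
  refine integral_congr_ae (Eventually.of_forall fun X => ?_)
  simp only
  rw [ENNReal.toReal_ofReal (by positivity)]

theorem integrable_weightMeasure_iff {E : Type*} [NormedAddCommGroup E] [NormedSpace ℝ E]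
    {f : Space d → E} :
    Integrable f (weightMeasure d a) ↔ Integrable fun X => |X.2.2| ^ a • f X := by
  rw [weightMeasure, integrable_withDensity_iff_integrable_smul' (by fun_prop)
    (Eventually.of_forall fun X => ENNReal.ofReal_lt_top)]
  refine integrable_congr (Eventually.of_forall fun X => ?_)
  simp only
  rw [ENNReal.toReal_ofReal (by positivity)]

/-- `G` is the weak gradient of the weak solution `u` of `L_a u = 0` in `Ω`, and it is locally in
`L²(|y|^a)`; a form of `IsAHarmonicOn` that is visibly linear. -/
structure IsWeakSolutionPair (a : ℝ) (Ω : Set (Space d)) (u : Space d → ℝ)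
    (G : Space d → Space d) : Prop where
  integrableOn : ∀ K ⊆ Ω, IsCompact K → IntegrableOn G K
  memLp : ∀ K ⊆ Ω, IsCompact K → MemLp (K.indicator G) 2 (weightMeasure d a)
  grad : ∀ φ, IsTest Ω φ → ∀ e, ∫ X, u X * fderiv ℝ φ X e = - ∫ X, dot (G X) e * φ X
  eqn : ∀ φ, IsTest Ω φ → ∫ X, fderiv ℝ φ X (G X) ∂(weightMeasure d a) = 0

theorem IsAHarmonicOn.exists_pair {Ω : Set (Space d)} {u : Space d → ℝ}
    (h : IsAHarmonicOn a Ω u) : ∃ G, IsWeakSolutionPair a Ω u G := by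
  obtain ⟨G, ⟨hu, hG, hgrad⟩, -, h2, heq⟩ := h
  refine ⟨G, fun K hK hKc => hG.integrableOn_compact_subset hK hKc, fun K hK hKc => ?_, hgrad,
    fun φ hφ => ?_⟩
  · have hm : AEStronglyMeasurable (K.indicator G) volume :=
      (aestronglyMeasurable_indicator_iff hKc.measurableSet).2
        (hG.integrableOn_compact_subset hK hKc).1
    rw [memLp_two_iff_integrable_sq_norm (hm.mono_ac weightMeasure_absolutelyContinuous),
      integrable_weightMeasure_iff]
    have h3 : Integrable (K.indicator fun X => |X.2.2| ^ a * dot (G X) (G X)) :=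
      (h2.integrableOn_compact_subset hK hKc).integrable_indicator hKc.measurableSet
    refine h3.mono' (measurable_weight.aestronglyMeasurable.smul (hm.norm.pow 2))
      (Eventually.of_forall fun X => ?_)
    by_cases hX : X ∈ K
    · rw [indicator_of_mem hX, indicator_of_mem hX, smul_eq_mul, Real.norm_of_nonneg (by positivity)]
      gcongr
      exact norm_sq_le_dot _
    · simp [hX]
  · rw [integral_weightMeasure]
    exact heq φ hφ

theorem IsTest.integrable_fderiv_mul {Ω : Set (Space d)} {φ : Space d → ℝ} (hφ : IsTest Ω φ)
    {u : Space d → ℝ} (hu : Continuous u) (e : Space d) :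
    Integrable fun X => u X * fderiv ℝ φ X e := by
  refine Continuous.integrable_of_hasCompactSupport ?_ ?_
  · exact hu.mul ((hφ.1.continuous_fderiv (by simp)).clm_apply continuous_const)
  · exact ((hφ.2.1.fderiv_apply (𝕜 := ℝ) e)).mul_left

/-- The identities are linear, but an integral may be split only when both parts converge.
Continuity of u and u', local integrability of the gradients, and L² ⊆ L¹ on compact sets for the
weighted measure provide this. -/
theorem IsWeakSolutionPair.sub {Ω : Set (Space d)} {u u' : Space d → ℝ}
    {G G' : Space d → Space d} (ha : a ∈ Ioo (-1 : ℝ) 0) (hu : Continuous u) (hu' : Continuous u')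
    (h : IsWeakSolutionPair a Ω u G)
    (h' : IsWeakSolutionPair a Ω u' G') : IsWeakSolutionPair a Ω (u - u') (G - G') := by
  have := isLocallyFiniteMeasure_weightMeasure (d := d) ha
  refine ⟨fun K hK hKc => (h.integrableOn K hK hKc).sub (h'.integrableOn K hK hKc),
    fun K hK hKc => ?_, fun φ hφ e => ?_, fun φ hφ => ?_⟩
  · rw [indicator_sub']
    exact (h.memLp K hK hKc).sub (h'.memLp K hK hKc)
  · have key : ∀ {H : Space d → Space d} {w : Space d → ℝ}, IsWeakSolutionPair a Ω w H →
        Integrable fun X => dot (H X) e * φ X := by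
      intro H w hH
      have h1 : IntegrableOn (fun X => dot (H X) e * φ X) (tsupport φ) := by
        have h2 : IntegrableOn (fun X => dot (H X) e) (tsupport φ) := by
          simpa only [IntegrableOn, dotCLM_apply] using
            (dotCLM e).integrable_comp (hH.integrableOn _ hφ.2.2 hφ.2.1)
        exact h2.mul_continuousOn hφ.1.continuous.continuousOn hφ.2.1
      refine (integrableOn_iff_integrable_of_support_subset ?_).1 h1
      exact (Function.support_mul_subset_right _ _).trans (subset_tsupport φ)
    simp only [Pi.sub_apply, sub_mul, dot_sub_left]
    rw [integral_sub (hφ.integrable_fderiv_mul hu e) (hφ.integrable_fderiv_mul hu' e),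
      integral_sub (key h) (key h'), h.grad φ hφ e, h'.grad φ hφ e]
    ring
  · have key : ∀ {H : Space d → Space d} {w : Space d → ℝ}, IsWeakSolutionPair a Ω w H →
        Integrable (fun X => fderiv ℝ φ X (H X)) (weightMeasure d a) := by
      intro H w hH
      have hfd : Continuous (fderiv ℝ φ) := hφ.1.continuous_fderiv (by simp)
      set K := tsupport φ
      have hm := hH.memLp K hφ.2.2 hφ.2.1
      have h1 : MemLp (K.indicator H) 2 ((weightMeasure d a).restrict K) := hm.restrict K
      have : IsFiniteMeasure ((weightMeasure d a).restrict K) :=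
        ⟨by rw [Measure.restrict_apply_univ]; exact hφ.2.1.measure_lt_top⟩
      have h2 : IntegrableOn (K.indicator H) K (weightMeasure d a) :=
        h1.integrable (by norm_num)
      have h3 : Integrable (K.indicator H) (weightMeasure d a) := by
        refine (integrableOn_iff_integrable_of_support_subset ?_).1 h2
        exact support_indicator_subset
      obtain ⟨C, hC⟩ := hfd.bounded_above_of_compact_support (hφ.2.1.fderiv (𝕜 := ℝ))
      have heq : (fun X => fderiv ℝ φ X (H X)) = fun X => fderiv ℝ φ X (K.indicator H X) := by
        ext1 X
        by_cases hX : X ∈ K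
        · rw [indicator_of_mem hX]
        · have : fderiv ℝ φ X = 0 := by
            by_contra hne
            exact hX (support_fderiv_subset ℝ hne)
          simp [this]
      rw [heq]
      refine (h3.norm.const_mul C).mono' ?_ (Eventually.of_forall fun X => ?_)
      · exact isBoundedBilinearMap_apply.continuous.comp_aestronglyMeasurable
          (hfd.aestronglyMeasurable.prodMk h3.1)
      · exact ((fderiv ℝ φ X).le_opNorm _).trans (by gcongr; exact hC X)
    simp only [Pi.sub_apply, map_sub]
    rw [integral_sub (key h) (key h'), h.eqn φ hφ, h'.eqn φ hφ, sub_zero]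

/-- The gradient of the mollification is the mollification of the weak gradient. -/
theorem IsWeakSolutionPair.fderiv_mollify {Ω : Set (Space d)} {u : Space d → ℝ}
    {G : Space d → Space d} (hu : Continuous u) (h : IsWeakSolutionPair a Ω u G) {K : Set (Space d)}
    (hK : IsCompact K) (hKΩ : K ⊆ Ω) {k : ℕ} {X : Space d}
    (hX : Metric.closedBall X (shrinkingBump d k).rOut ⊆ K) (e : Space d) :
    fderiv ℝ (mollify k u) X e = dot (mollify k (K.indicator G) X) e := by
  have hψ := contDiff_mollifier (d := d) k
  have hψc := hasCompactSupport_mollifier (d := d) k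
  have hG : Integrable (K.indicator G) := (h.integrableOn K hKΩ hK).integrable_indicator
    hK.measurableSet
  have h1 : fderiv ℝ (mollify k u) X e = ∫ Y, fderiv ℝ (mollifier d k) (X - Y) e * u Y := by
    have hd := (hψc.hasFDerivAt_convolution_left (ContinuousLinearMap.lsmul ℝ ℝ)
      (hψ.of_le (by simp)) (hu.locallyIntegrable (μ := volume)) X)
    have hex : ConvolutionExists (fderiv ℝ (mollifier d k)) u
        (ContinuousLinearMap.precompL (Space d) (ContinuousLinearMap.lsmul ℝ ℝ)) volume :=
      (hψc.fderiv (𝕜 := ℝ)).convolutionExists_left _ (hψ.continuous_fderiv (by simp))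
        hu.locallyIntegrable
    rw [mollify, hd.fderiv, convolution_eq_swap,
      ContinuousLinearMap.integral_apply (hex X).integrable_swap]
    rfl
  -- The reflected and translated mollifier is itself a test function in Ω, because its support lies
  -- in a ball inside K. The definition of the weak gradient applied to it gives the claim.
  have htest : IsTest Ω fun Y => mollifier d k (X - Y) := by
    have hsub : tsupport (fun Y => mollifier d k (X - Y))
        ⊆ Metric.closedBall X (shrinkingBump d k).rOut := by
      refine closure_minimal (fun Y hY => ?_) Metric.isClosed_closedBall
      by_contra hne
      exact hY (mollifier_sub_eq_zero hne)
    exact ⟨hψ.comp (contDiff_const.sub contDiff_id),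
      HasCompactSupport.of_support_subset_isCompact (isCompact_closedBall X _)
        ((subset_tsupport _).trans hsub), hsub.trans (hX.trans hKΩ)⟩
  have h2 : ∀ Y, fderiv ℝ (fun Y => mollifier d k (X - Y)) Y e
      = - fderiv ℝ (mollifier d k) (X - Y) e := by
    intro Y
    have hd : HasFDerivAt (mollifier d k) (fderiv ℝ (mollifier d k) (X - Y)) (X - Y) :=
      (hψ.differentiable (by simp) _).hasFDerivAt
    have := hd.comp Y ((hasFDerivAt_id Y).const_sub X)
    change fderiv ℝ (mollifier d k ∘ HSub.hSub X) Y e = _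
    rw [HasFDerivAt.fderiv this]
    simp
  have h3 := h.grad _ htest e
  simp only [h2, mul_neg, integral_neg, neg_inj] at h3
  rw [h1, mollify_apply, ← dotCLM_apply]
  have hint : Integrable fun Y => mollifier d k (X - Y) • K.indicator G Y :=
    hG.locallyIntegrable.integrable_smul_left_of_hasCompactSupport htest.1.continuous htest.2.1
  rw [← ContinuousLinearMap.integral_comp_comm _ hint]
  calc _ = ∫ Y, u Y * fderiv ℝ (mollifier d k) (X - Y) e := by simp only [mul_comm]
    _ = _ := h3
    _ = _ := by
        refine integral_congr_ae (Eventually.of_forall fun Y => ?_)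
        simp only
        by_cases hY : Y ∈ Metric.closedBall X (shrinkingBump d k).rOut
        · rw [indicator_of_mem (hX hY), map_smul, dotCLM_apply, smul_eq_mul, mul_comm]
        · rw [mollifier_sub_eq_zero hY]
          simp

/-! ### The maximum principle and uniqueness -/

theorem isClosed_thinSet (d : ℕ) : IsClosed (thinSet d) :=
  (isClosed_eq (by fun_prop) continuous_const).inter (isClosed_eq (by fun_prop) continuous_const)

/-- A Poincaré inequality in the direction of `x_n`. -/
theorem integral_sq_le_integral_fderiv_sq {f : Space d → ℝ} (hf : ContDiff ℝ 1 f)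
    (hc : HasCompactSupport f) {R : ℝ} (hR : ∀ X, f X ≠ 0 → |X.2.1| ≤ R) :
    ∫ X, f X ^ 2 ≤ 4 * R ^ 2 * ∫ X, fderiv ℝ f X (0, 1, 0) ^ 2 := by
  have hfd : Continuous fun X => fderiv ℝ f X (0, 1, 0) :=
    (hf.continuous_fderiv (by simp)).clm_apply continuous_const
  have hfdc : HasCompactSupport fun X => fderiv ℝ f X (0, 1, 0) := hc.fderiv_apply (𝕜 := ℝ) _
  have hcont := hf.continuous
  have hsq : Integrable fun X => f X ^ 2 := by
    refine (hcont.pow 2).integrable_of_hasCompactSupport ?_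
    simpa only [pow_two] using! hc.mul_left (f := f)
  have hdsq : Integrable fun X => fderiv ℝ f X (0, 1, 0) ^ 2 := by
    refine (hfd.pow 2).integrable_of_hasCompactSupport ?_
    simpa only [pow_two] using! hfdc.mul_left (f := fun X => fderiv ℝ f X (0, 1, 0))
  have hint : Integrable fun X : Space d => X.2.1 * (2 * f X * fderiv ℝ f X (0, 1, 0)) := by
    refine Continuous.integrable_of_hasCompactSupport (by fun_prop) ?_
    exact (hfdc.mul_left (f := fun X => 2 * f X)).mul_left
  have hx : Integrable fun X : Space d => X.2.1 * f X ^ 2 := by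
    refine Continuous.integrable_of_hasCompactSupport (by fun_prop) ?_
    refine HasCompactSupport.mul_left ?_
    simpa only [pow_two] using! hc.mul_left (f := f)
  -- Integration by parts with 1 = ∂_n x_n gives ∫ f² = -∫ x_n · 2 f ∂_n f.
  have key := integral_bilinear_hasLineDerivAt_right_eq_neg_left_of_integrable
    (μ := (volume : Measure (Space d)))
    (f := fun X : Space d => X.2.1) (f' := fun _ => (1 : ℝ)) (g := fun X => f X ^ 2)
    (g' := fun X => 2 * f X * fderiv ℝ f X (0, 1, 0)) (v := ((0, 1, 0) : Space d))
    (B := ContinuousLinearMap.mul ℝ ℝ)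
    (by simpa using hsq) (by simpa using hint) (by simpa using hx)
    (fun X _ => by
      have : HasFDerivAt (fun X : Space d => X.2.1)
          ((ContinuousLinearMap.fst ℝ ℝ ℝ).comp (ContinuousLinearMap.snd ℝ _ _)) X :=
        hasFDerivAt_snd.fst
      simpa using this.hasLineDerivAt (0, 1, 0))
    (fun X _ => by
      have h1 : HasFDerivAt f (fderiv ℝ f X) X :=
        (hf.differentiable (by simp) X).hasFDerivAt
      simpa [mul_assoc] using (h1.pow 2).hasLineDerivAt (0, 1, 0))
  simp only [ContinuousLinearMap.mul_apply', one_mul] at key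
  -- Young's inequality with |x_n| ≤ R on the support leaves half of ∫ f², which is absorbed on the
  -- left; hence the factor 4 R².
  have hle : ∫ X, f X ^ 2 ≤ ∫ X, (f X ^ 2 / 2 + 2 * R ^ 2 * fderiv ℝ f X (0, 1, 0) ^ 2) := by
    rw [← neg_eq_iff_eq_neg.2 key, ← integral_neg]
    refine integral_mono hint.neg ((hsq.div_const 2).add (hdsq.const_mul _)) fun X => ?_
    simp only
    by_cases h0 : f X = 0
    · simp only [h0]
      have : 0 ≤ 2 * R ^ 2 * fderiv ℝ f X (0, 1, 0) ^ 2 := by positivity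
      simpa using this
    · have h1 : X.2.1 ^ 2 ≤ R ^ 2 := sq_le_sq' (abs_le.1 (hR X h0)).1 (abs_le.1 (hR X h0)).2
      have h2 : X.2.1 ^ 2 * fderiv ℝ f X (0, 1, 0) ^ 2 ≤ R ^ 2 * fderiv ℝ f X (0, 1, 0) ^ 2 := by
        gcongr
      nlinarith [sq_nonneg (f X + 2 * (X.2.1 * fderiv ℝ f X (0, 1, 0)))]
  rw [integral_add (hsq.div_const 2) (hdsq.const_mul _), integral_div, integral_const_mul] at hle
  linarith

theorem tendsto_integral_norm_sq {α E : Type*} [MeasurableSpace α] {μ : Measure α}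
    [NormedAddCommGroup E] {f : ℕ → α → E} (hf : ∀ k, MemLp (f k) 2 μ)
    (h : Tendsto (fun k => eLpNorm (f k) 2 μ) atTop (𝓝 0)) :
    Tendsto (fun k => ∫ x, ‖f k x‖ ^ 2 ∂μ) atTop (𝓝 0) := by
  have h1 : ∀ k, ∫ x, ‖f k x‖ ^ 2 ∂μ = (eLpNorm (f k) 2 μ).toReal ^ 2 := by
    intro k
    have hn : 0 ≤ ∫ x, ‖f k x‖ ^ 2 ∂μ := integral_nonneg fun x => by positivity
    rw [(hf k).eLpNorm_eq_integral_rpow_norm (by norm_num) (by norm_num)]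
    simp only [ENNReal.toReal_ofNat, Real.rpow_ofNat]
    rw [ENNReal.toReal_ofReal (by positivity), ← Real.rpow_natCast, ← Real.rpow_mul hn]
    norm_num
  simp only [h1]
  have h2 := ((ENNReal.tendsto_toReal ENNReal.zero_ne_top).comp h).pow 2
  simpa using h2

set_option maxHeartbeats 1600000 in
/-- The weak maximum principle off the thin set. -/
theorem IsWeakSolutionPair.nonpos {W : Space d → ℝ} {G : Space d → Space d}
    (ha : a ∈ Ioo (-1 : ℝ) 0) (hW : Continuous W) (hdecay : Tendsto W (cocompact (Space d)) (𝓝 0))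
    (hzero : ∀ X ∈ thinSet d, W X = 0) (h : IsWeakSolutionPair a (thinSet d)ᶜ W G)
    (X₀ : Space d) : W X₀ ≤ 0 := by
  by_contra! hpos
  -- Three levels are used: ε defines the compact set K, the cutoff starts at 2ε, and W X₀ = 3ε. The
  -- gaps leave room for a mollification error of ε/4.
  set ε := W X₀ / 3 with hεdef
  have hε : 0 < ε := by positivity
  set K := {X | ε ≤ W X} with hKdef
  have hKc : IsCompact K := by
    obtain ⟨t, ht, hsub⟩ := mem_cocompact.1 (hdecay.eventually (gt_mem_nhds hε))
    refine ht.of_isClosed_subset (isClosed_le continuous_const hW) fun X hX => ?_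
    by_contra hne
    exact (not_lt.2 (show ε ≤ W X from hX)) (show W X < ε from hsub hne)
  have hKΩ : K ⊆ (thinSet d)ᶜ := fun X hX hthin => by
    have : ε ≤ W X := hX
    rw [hzero X hthin] at this
    linarith
  -- A thickening of K that stays off the thin set, so that mollifying at a point of K uses the
  -- gradient only inside a compact subset of Ω.
  obtain ⟨δ, hδ, hK'Ω⟩ := hKc.exists_cthickening_subset_open (isClosed_thinSet d).isOpen_compl hKΩ
  set K' := Metric.cthickening δ K
  have hK'c : IsCompact K' := hKc.cthickening
  obtain ⟨R, hR⟩ := hKc.isBounded.exists_norm_le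
  obtain ⟨B, hB⟩ := hKc.exists_bound_of_continuousOn hW.continuousOn
  set R' := max R 1
  have hR'pos : 0 < R' := lt_max_of_lt_right one_pos
  -- A smooth nondecreasing substitute for (t - 2ε)₊; composed with the mollified W it gives a
  -- smooth test function supported in K.
  set Φ : ℝ → ℝ := fun t => expNegInvGlue (t - 2 * ε)
  have hΦ : ContDiff ℝ ∞ Φ := expNegInvGlue.contDiff.comp (contDiff_id.sub contDiff_const)
  have hΦ' : Continuous (deriv Φ) := hΦ.continuous_deriv (by simp)
  have hΦ'0 : ∀ t, 0 ≤ deriv Φ t := fun t => Monotone.deriv_nonneg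
    (fun s t hst => expNegInvGlue.monotone (by linarith))
  have hΦz : ∀ t, t ≤ 2 * ε → Φ t = 0 := fun t ht =>
    expNegInvGlue.zero_of_nonpos (by linarith)
  have hΦ'z : ∀ t, t ≤ 2 * ε → deriv Φ t = 0 := fun t ht => by
    refine IsLocalMin.deriv_eq_zero (Eventually.of_forall fun s => ?_)
    rw [hΦz t ht]
    exact expNegInvGlue.nonneg _
  -- Where the mollified W exceeds 2ε the point lies in K, and there it is at most B + ε/4; so this
  -- interval contains every value at which Φ' can be nonzero.
  obtain ⟨M, hM⟩ := (isCompact_Icc (a := 2 * ε) (b := max B 0 + ε)).exists_bound_of_continuousOn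
    hΦ'.continuousOn
  set M' := max M 0
  have hM' : 0 ≤ M' := le_max_right _ _
  set G₁ := K'.indicator G
  have hG₁ : Integrable G₁ := (h.integrableOn K' hK'Ω hK'c).integrable_indicator
    hK'c.measurableSet
  have hG₁2 : MemLp G₁ 2 (weightMeasure d a) := h.memLp K' hK'Ω hK'c
  have hmem : ∀ k, MemLp (mollify k G₁) 2 (weightMeasure d a) := fun k => by
    obtain ⟨C, hC, hbd⟩ := exists_eLpNorm_mollify_le (E := Space d) d ha
    exact ⟨(continuous_mollify k hG₁.locallyIntegrable).aestronglyMeasurable,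
      (hbd k G₁ hG₁.1).trans_lt (ENNReal.mul_lt_top hC.lt_top hG₁2.2)⟩
  set D := fun k => mollify k G₁ - G₁
  have hD : Tendsto (fun k => ∫ X, ‖D k X‖ ^ 2 ∂(weightMeasure d a)) atTop (𝓝 0) :=
    tendsto_integral_norm_sq (fun k => (hmem k).sub hG₁2)
      (tendsto_eLpNorm_mollify_sub ha hG₁.locallyIntegrable hG₁2)
  have hWl : LocallyIntegrable W := hW.locallyIntegrable
  obtain ⟨η, hη, hunif⟩ := Metric.uniformContinuous_iff.1
    (hW.uniformContinuous_of_tendsto_cocompact hdecay) (ε / 4) (by positivity)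
  -- Product of the Poincaré constant, the cost M' R'^(-a) of discarding the weight and one factor
  -- Φ', and the energy constant 3 M'.
  set C := 4 * R' ^ 2 * (M' * R' ^ (-a) * (3 * M'))
  have hC : 0 ≤ C := by positivity
  -- Within η of X₀ the mollified W is at least 3ε - ε/4 - ε/4 = 5ε/2, which bounds ∫ f² below
  -- independently of k.
  set c := Φ (5 * ε / 2) ^ 2 * volume.real (Metric.ball X₀ η)
  have hc : 0 < c := by
    refine mul_pos (pow_pos (expNegInvGlue.pos_of_pos (by linarith)) 2) ?_
    exact ENNReal.toReal_pos (Metric.measure_ball_pos _ _ hη).ne' measure_ball_lt_top.ne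
  have hev : ∀ᶠ k in atTop, c ≤ C * ∫ X, ‖D k X‖ ^ 2 ∂(weightMeasure d a) := by
    filter_upwards [(tendsto_shrinkingBump_rOut d).eventually (gt_mem_nhds hη),
      (tendsto_shrinkingBump_rOut d).eventually (gt_mem_nhds hδ)] with k hkη hkδ
    have hWk : ∀ X, |mollify k W X - W X| ≤ ε / 4 := fun X =>
      dist_mollify_le k hW.aestronglyMeasurable fun Y hY =>
        (hunif ((Metric.mem_ball.1 hY).trans hkη)).le
    have hWks : ContDiff ℝ ∞ (mollify k W) :=
      (hasCompactSupport_mollifier k).contDiff_convolution_left _ (contDiff_mollifier k) hWl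
    have hK2 : ∀ X, X ∉ K → mollify k W X ≤ 2 * ε := fun X hX => by
      have h1 : W X < ε := not_le.1 hX
      linarith [(abs_le.1 (hWk X)).2]
    have hfd : ∀ X ∈ K, ∀ e, fderiv ℝ (mollify k W) X e = dot (mollify k G₁ X) e := fun X hX e =>
      h.fderiv_mollify hW hK'c hK'Ω
        ((Metric.closedBall_subset_cthickening hX _).trans (Metric.cthickening_mono hkδ.le K)) e
    set H : Space d → ℝ := fun X => deriv Φ (mollify k W X)
    have hHc : Continuous H := hΦ'.comp hWks.continuous
    have hH0 : ∀ X, 0 ≤ H X := fun X => hΦ'0 _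
    have hHz : ∀ X, X ∉ K → H X = 0 := fun X hX => hΦ'z _ (hK2 X hX)
    have hHM : ∀ X, H X ≤ M' := fun X => by
      by_cases hX : mollify k W X ≤ 2 * ε
      · rw [show H X = 0 from hΦ'z _ hX]
        exact hM'
      · have hXK : X ∈ K := by
          by_contra hne
          exact hX (hK2 X hne)
        refine (le_abs_self _).trans ((hM _ ⟨(not_le.1 hX).le, ?_⟩).trans (le_max_left _ _))
        have h1 := (le_abs_self _).trans (hB X hXK)
        have h2 := (abs_le.1 (hWk X)).2
        linarith [le_max_left B 0]
    set f : Space d → ℝ := fun X => Φ (mollify k W X)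
    have hf : ContDiff ℝ ∞ f := hΦ.comp hWks
    have hfK : tsupport f ⊆ K := by
      refine closure_minimal (fun X hX => ?_) hKc.isClosed
      by_contra hne
      exact hX (hΦz _ (hK2 X hne))
    have hfc : HasCompactSupport f :=
      HasCompactSupport.of_support_subset_isCompact hKc ((subset_tsupport f).trans hfK)
    have hffd : ∀ X e, fderiv ℝ f X e = H X * dot (mollify k G₁ X) e := fun X e => by
      have h1 : HasFDerivAt f (deriv Φ (mollify k W X) • fderiv ℝ (mollify k W) X) X :=
        HasDerivAt.comp_hasFDerivAt X (hΦ.differentiable (by simp) _).hasDerivAt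
          (hWks.differentiable (by simp) X).hasFDerivAt
      rw [h1.fderiv]
      change H X * fderiv ℝ (mollify k W) X e = _
      by_cases hX : X ∈ K
      · rw [hfd X hX]
      · rw [hHz X hX, zero_mul, zero_mul]
    -- The equation pairs the true gradient G₁ with the gradient of the test function, which
    -- involves the mollified gradient.
    have heqn : ∫ X, H X * dot (mollify k G₁ X) (G₁ X) ∂(weightMeasure d a) = 0 := by
      rw [← h.eqn f ⟨hf, hfc, hfK.trans hKΩ⟩]
      refine integral_congr_ae (Eventually.of_forall fun X => ?_)
      simp only
      rw [hffd]
      by_cases hX : X ∈ K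
      · rw [show G₁ X = G X from indicator_of_mem (Metric.self_subset_cthickening K hX) G]
      · rw [hHz X hX, zero_mul, zero_mul]
    have hint : ∀ {P Q : Space d → Space d}, MemLp P 2 (weightMeasure d a) →
        MemLp Q 2 (weightMeasure d a) →
        Integrable (fun X => H X * dot (P X) (Q X)) (weightMeasure d a) := by
      intro P Q hP hQ
      have hP2 := (memLp_two_iff_integrable_sq_norm hP.1).1 hP
      have hQ2 := (memLp_two_iff_integrable_sq_norm hQ.1).1 hQ
      refine ((hP2.add hQ2).const_mul (M' * 3)).mono' ?_ (Eventually.of_forall fun X => ?_)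
      · exact hHc.aestronglyMeasurable.mul
          (continuous_dot.comp_aestronglyMeasurable (hP.1.prodMk hQ.1))
      · rw [norm_mul, Real.norm_of_nonneg (hH0 X), mul_assoc]
        refine mul_le_mul (hHM X) ((abs_dot_le _ _).trans ?_) (norm_nonneg _) hM'
        simp only [Pi.add_apply]
        nlinarith [sq_nonneg (‖P X‖ - ‖Q X‖), sq_nonneg ‖P X‖, sq_nonneg ‖Q X‖]
    have hDm : MemLp (D k) 2 (weightMeasure d a) := (hmem k).sub hG₁2
    -- With P the mollified gradient and D = P - G₁, Young's inequality for P·D gives P·P ≤ 2 P·G₁ +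
    -- D·D. Integrated against H, the middle term vanishes by `heqn`, so the energy is controlled by
    -- the mollification error.
    have henergy : ∫ X, H X * dot (mollify k G₁ X) (mollify k G₁ X) ∂(weightMeasure d a)
        ≤ 3 * M' * ∫ X, ‖D k X‖ ^ 2 ∂(weightMeasure d a) := by
      have hD2 := (memLp_two_iff_integrable_sq_norm hDm.1).1 hDm
      calc _ ≤ ∫ X, (2 * (H X * dot (mollify k G₁ X) (G₁ X)) + 3 * M' * ‖D k X‖ ^ 2)
            ∂(weightMeasure d a) := by
            refine integral_mono (hint (hmem k) (hmem k))
              (((hint (hmem k) hG₁2).const_mul 2).add (hD2.const_mul _)) fun X => ?_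
            simp only
            have h1 := two_mul_dot_le (mollify k G₁ X) (D k X)
            have h2 : dot (mollify k G₁ X) (D k X)
                = dot (mollify k G₁ X) (mollify k G₁ X) - dot (mollify k G₁ X) (G₁ X) :=
              dot_sub_right _ _ _
            have h3 : dot (mollify k G₁ X) (mollify k G₁ X)
                ≤ 2 * dot (mollify k G₁ X) (G₁ X) + dot (D k X) (D k X) := by linarith
            have h4 := mul_le_mul_of_nonneg_left h3 (hH0 X)
            have h5 : H X * dot (D k X) (D k X) ≤ M' * (3 * ‖D k X‖ ^ 2) :=
              mul_le_mul (hHM X) (dot_self_le _) (dot_self_nonneg _) hM'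
            linarith
        _ = _ := by
            rw [integral_add ((hint (hmem k) hG₁2).const_mul 2) (hD2.const_mul _),
              integral_const_mul, integral_const_mul, heqn, mul_zero, zero_add]
    -- On K one has |y| ≤ R', and a < 0 gives 1 ≤ R'^(-a) |y|^a off y = 0. The weight is thus
    -- bounded below, and the unweighted Poincaré inequality suffices.
    have hgrad : ∫ X, fderiv ℝ f X (0, 1, 0) ^ 2
        ≤ M' * R' ^ (-a) * ∫ X, H X * dot (mollify k G₁ X) (mollify k G₁ X)
          ∂(weightMeasure d a) := by
      have hi := integrable_weightMeasure_iff.1 (hint (hmem k) (hmem k))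
      rw [integral_weightMeasure, ← integral_const_mul]
      refine integral_mono_of_nonneg (Eventually.of_forall fun X => sq_nonneg _)
        (hi.const_mul _) ?_
      filter_upwards [ae_y_ne_zero (d := d)] with X hy
      rw [hffd, smul_eq_mul]
      set P := mollify k G₁ X
      by_cases hX : X ∈ K
      · have hy0 : 0 < |X.2.2| := abs_pos.2 hy
        have h1 : |X.2.2| ≤ R' :=
          ((norm_snd_le X.2).trans (norm_snd_le X)).trans ((hR X hX).trans (le_max_left _ _))
        have h2 : 1 ≤ R' ^ (-a) * |X.2.2| ^ a := by
          rw [Real.rpow_neg hR'pos.le, ← div_eq_inv_mul, one_le_div (by positivity)]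
          exact Real.rpow_le_rpow_of_nonpos hy0 h1 ha.2.le
        have h3 : dot P (0, 1, 0) ^ 2 ≤ dot P P := by
          have : dot P (0, 1, 0) = P.2.1 := by simp [dot]
          rw [this]
          have h5 : 0 ≤ inner ℝ P.1 P.1 := real_inner_self_nonneg
          simp only [dot]
          nlinarith [mul_self_nonneg P.2.2]
        calc (H X * dot P (0, 1, 0)) ^ 2 = H X * (H X * dot P (0, 1, 0) ^ 2) := by ring
          _ ≤ M' * (H X * dot P P) := by
              gcongr
              · exact mul_nonneg (hH0 X) (sq_nonneg _)
              · exact hHM X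
              · exact hH0 X
          _ ≤ M' * (H X * dot P P) * (R' ^ (-a) * |X.2.2| ^ a) :=
              le_mul_of_one_le_right
                (mul_nonneg hM' (mul_nonneg (hH0 X) (dot_self_nonneg P))) h2
          _ = _ := by ring
      · rw [hHz X hX]
        simp
    have hpoin := integral_sq_le_integral_fderiv_sq (hf.of_le (by simp)) hfc (R := R')
      fun X hX => ((norm_fst_le X.2).trans (norm_snd_le X)).trans
        ((hR X (hfK (subset_tsupport f hX))).trans (le_max_left _ _))
    have hlow : c ≤ ∫ X, f X ^ 2 := by
      have hfi : Integrable fun X => f X ^ 2 := by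
        refine (hf.continuous.pow 2).integrable_of_hasCompactSupport ?_
        simpa only [pow_two] using! hfc.mul_left (f := f)
      calc c = ∫ X in Metric.ball X₀ η, Φ (5 * ε / 2) ^ 2 := by
            rw [setIntegral_const, smul_eq_mul, mul_comm]
        _ ≤ ∫ X in Metric.ball X₀ η, f X ^ 2 := by
            refine setIntegral_mono_on (integrableOn_const measure_ball_lt_top.ne) hfi.integrableOn
              measurableSet_ball fun X hX => ?_
            refine pow_le_pow_left₀ (expNegInvGlue.nonneg _) (expNegInvGlue.monotone ?_) 2
            have h1 := hunif (Metric.mem_ball.1 hX)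
            rw [Real.dist_eq] at h1
            have h2 := (abs_lt.1 h1).1
            have h3 := (abs_le.1 (hWk X)).1
            have h4 : W X₀ = 3 * ε := by rw [hεdef]; ring
            linarith
        _ ≤ _ := setIntegral_le_integral hfi (Eventually.of_forall fun X => sq_nonneg _)
    calc c ≤ 4 * R' ^ 2 * ∫ X, fderiv ℝ f X (0, 1, 0) ^ 2 := hlow.trans hpoin
      _ ≤ 4 * R' ^ 2 * (M' * R' ^ (-a) * (3 * M' * ∫ X, ‖D k X‖ ^ 2 ∂(weightMeasure d a))) := by
          gcongr
          exact hgrad.trans (by gcongr)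
      _ = _ := by ring
  have hlim := hD.const_mul C
  rw [mul_zero] at hlim
  exact absurd (ge_of_tendsto hlim hev) (not_le.2 hc)

/-- Uniqueness of the `a`-harmonic extension. -/
theorem IsAHarmonicExtension.unique {v : EuclideanSpace ℝ (Fin d) → ℝ} {V V' : Space d → ℝ}
    (ha : a ∈ Ioo (-1 : ℝ) 0) (h : IsAHarmonicExtension a v V) (h' : IsAHarmonicExtension a v V') :
    V = V' := by
  have key : ∀ {U U' : Space d → ℝ}, IsAHarmonicExtension a v U → IsAHarmonicExtension a v U' →
      ∀ X, U X ≤ U' X := by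
    intro U U' hU hU' X
    obtain ⟨G, hG⟩ := hU.harmonic.exists_pair
    obtain ⟨G', hG'⟩ := hU'.harmonic.exists_pair
    have := (hG.sub ha hU.continuous hU'.continuous hG').nonpos ha
      (hU.continuous.sub hU'.continuous) (by simpa using! hU.decay.sub hU'.decay)
      (fun Y hY => by
        obtain ⟨x, s, y⟩ := Y
        obtain ⟨rfl, rfl⟩ : s = 0 ∧ y = 0 := hY
        simp [hU.trace, hU'.trace]) X
    simpa using this
  ext1 X
  exact le_antisymm (key h h' X) (key h' h X)

/-! ### The Poisson kernel as a weak solution off the thin set -/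

theorem dotCLM_smul (c : ℝ) (P : Space d) : dotCLM (c • P) = c • dotCLM P := by
  refine ContinuousLinearMap.ext fun e => ?_
  rw [smul_apply, dotCLM_apply, dotCLM_apply, dot_comm, ← dotCLM_apply, map_smul, dotCLM_apply,
    dot_comm]

theorem dotCLM_add (P Q : Space d) : dotCLM (P + Q) = dotCLM P + dotCLM Q := by
  refine ContinuousLinearMap.ext fun e => ?_
  rw [add_apply, dotCLM_apply, dotCLM_apply, dotCLM_apply, dot_comm, ← dotCLM_apply, map_add,
    dotCLM_apply, dotCLM_apply, dot_comm, dot_comm Q]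

/-- `x_n² + y²`, the squared distance to the thin set. -/
def radSq (X : Space d) : ℝ := X.2.1 ^ 2 + X.2.2 ^ 2

/-- The squared distance to the point `(z, 0, 0)` of the thin set. -/
def distSq (z : EuclideanSpace ℝ (Fin d)) (X : Space d) : ℝ := ‖X.1 - z‖ ^ 2 + radSq X

/-- The product of a power of `radSq` and a power of `distSq`. -/
def radDist (p r : ℝ) (z : EuclideanSpace ℝ (Fin d)) (X : Space d) : ℝ :=
  radSq X ^ p * distSq z X ^ r

/-- The gradient of `radDist p r z` off the thin set. -/
def gradRadDist (p r : ℝ) (z : EuclideanSpace ℝ (Fin d)) (X : Space d) : Space d :=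
  ((2 * r * radDist p (r - 1) z X) • (X.1 - z),
    (2 * p * radDist (p - 1) r z X + 2 * r * radDist p (r - 1) z X) * X.2.1,
    (2 * p * radDist (p - 1) r z X + 2 * r * radDist p (r - 1) z X) * X.2.2)

theorem radSq_nonneg (X : Space d) : 0 ≤ radSq X := by
  unfold radSq
  positivity

theorem mem_compl_thinSet_iff {X : Space d} : X ∈ (thinSet d)ᶜ ↔ 0 < radSq X := by
  rw [(radSq_nonneg X).lt_iff_ne', mem_compl_iff, not_iff_not, radSq,
    add_eq_zero_iff_of_nonneg (sq_nonneg _) (sq_nonneg _), sq_eq_zero_iff, sq_eq_zero_iff]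
  rfl

theorem radSq_le_distSq (z : EuclideanSpace ℝ (Fin d)) (X : Space d) :
    radSq X ≤ distSq z X := by
  unfold distSq
  linarith [sq_nonneg ‖X.1 - z‖]

theorem continuous_radSq : Continuous (radSq (d := d)) := by
  unfold radSq
  fun_prop

theorem continuous_distSq :
    Continuous fun p : Space d × EuclideanSpace ℝ (Fin d) => distSq p.2 p.1 := by
  unfold distSq radSq
  fun_prop

theorem continuousAt_radDist {p r : ℝ} {P : Space d × EuclideanSpace ℝ (Fin d)}
    (hP : 0 < radSq P.1) :
    ContinuousAt (fun Q : Space d × EuclideanSpace ℝ (Fin d) => radDist p r Q.2 Q.1) P :=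
  ((continuous_radSq.comp continuous_fst).continuousAt.rpow_const (Or.inl hP.ne')).mul
    (continuous_distSq.continuousAt.rpow_const
      (Or.inl (hP.trans_le (radSq_le_distSq _ _)).ne'))

theorem continuousAt_gradRadDist {p r : ℝ} {P : Space d × EuclideanSpace ℝ (Fin d)}
    (hP : 0 < radSq P.1) :
    ContinuousAt (fun Q : Space d × EuclideanSpace ℝ (Fin d) => gradRadDist p r Q.2 Q.1) P := by
  have h1 : ContinuousAt (fun Q : Space d × EuclideanSpace ℝ (Fin d) =>
      2 * r * radDist p (r - 1) Q.2 Q.1) P := continuousAt_const.mul (continuousAt_radDist hP)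
  have h2 : ContinuousAt (fun Q : Space d × EuclideanSpace ℝ (Fin d) =>
      2 * p * radDist (p - 1) r Q.2 Q.1) P := continuousAt_const.mul (continuousAt_radDist hP)
  refine (h1.smul (Continuous.continuousAt (by fun_prop))).prodMk
    (((h2.add h1).mul (Continuous.continuousAt (by fun_prop))).prodMk
      ((h2.add h1).mul (Continuous.continuousAt (by fun_prop))))

theorem hasFDerivAt_radSq (X : Space d) :
    HasFDerivAt radSq (dotCLM (0, 2 * X.2.1, 2 * X.2.2)) X := by
  have h := (hasFDerivAt_snd (𝕜 := ℝ) (p := X)).fst.pow 2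
  have h' := (hasFDerivAt_snd (𝕜 := ℝ) (p := X)).snd.pow 2
  refine (h.add h').congr_fderiv ?_
  ext e <;> simp [dotCLM]

theorem hasFDerivAt_distSq (z : EuclideanSpace ℝ (Fin d)) (X : Space d) :
    HasFDerivAt (distSq z) (dotCLM ((2 : ℝ) • (X.1 - z), 2 * X.2.1, 2 * X.2.2)) X := by
  have h := ((hasFDerivAt_fst (𝕜 := ℝ) (p := X)).sub_const z).norm_sq
  refine (h.add (hasFDerivAt_radSq X)).congr_fderiv ?_
  ext e <;> simp [dotCLM]

/-- The family `radDist` is closed under differentiation: each derivative lowers one exponent by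
one, up to polynomial factors. Both first and second derivatives of the kernel come from this
formula. -/
theorem hasFDerivAt_radDist (p r : ℝ) (z : EuclideanSpace ℝ (Fin d)) {X : Space d}
    (hX : 0 < radSq X) :
    HasFDerivAt (radDist p r z) (dotCLM (gradRadDist p r z X)) X := by
  have h := (hasFDerivAt_radSq X).rpow_const (p := p) (Or.inl hX.ne')
  have h' := (hasFDerivAt_distSq z X).rpow_const (p := r)
    (Or.inl (hX.trans_le (radSq_le_distSq z X)).ne')
  refine (h.mul h').congr_fderiv ?_
  refine ContinuousLinearMap.ext fun e => ?_
  simp only [add_apply, smul_apply, dotCLM_apply, dot,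
    gradRadDist, radDist, smul_eq_mul, inner_zero_right, inner_smul_right]
  ring

/-- The value at `X` of the unnormalized Poisson kernel with pole `z`:
`r^{-a} (|x' - z|² + r²)^{-(d - a) / 2}`, `r² = x_n² + y²`. -/
def poissonKernel (a : ℝ) (z : EuclideanSpace ℝ (Fin d)) : Space d → ℝ :=
  radDist (-a / 2) (-((d : ℝ) - a) / 2) z

/-- The gradient of the Poisson kernel. -/
def gradKernel (a : ℝ) (z : EuclideanSpace ℝ (Fin d)) : Space d → Space d :=
  gradRadDist (-a / 2) (-((d : ℝ) - a) / 2) z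

/-- The coefficient of `X.1 - z` in the gradient of the Poisson kernel. -/
def tangCoeff (a : ℝ) (z : EuclideanSpace ℝ (Fin d)) (X : Space d) : ℝ :=
  2 * (-((d : ℝ) - a) / 2) * radDist (-a / 2) (-((d : ℝ) - a) / 2 - 1) z X

/-- The coefficient of `(x_n, y)` in the gradient of the Poisson kernel. -/
def normCoeff (a : ℝ) (z : EuclideanSpace ℝ (Fin d)) (X : Space d) : ℝ :=
  2 * (-a / 2) * radDist (-a / 2 - 1) (-((d : ℝ) - a) / 2) z X + tangCoeff a z X

theorem gradKernel_eq (z : EuclideanSpace ℝ (Fin d)) (X : Space d) :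
    gradKernel a z X = (tangCoeff a z X • (X.1 - z), normCoeff a z X * X.2.1,
      normCoeff a z X * X.2.2) := rfl

/-- The gradient of `tangCoeff`. -/
def gradTang (a : ℝ) (z : EuclideanSpace ℝ (Fin d)) (X : Space d) : Space d :=
  (2 * (-((d : ℝ) - a) / 2)) • gradRadDist (-a / 2) (-((d : ℝ) - a) / 2 - 1) z X

/-- The gradient of `normCoeff`. -/
def gradNorm (a : ℝ) (z : EuclideanSpace ℝ (Fin d)) (X : Space d) : Space d :=
  (2 * (-a / 2)) • gradRadDist (-a / 2 - 1) (-((d : ℝ) - a) / 2) z X + gradTang a z X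

theorem hasFDerivAt_tangCoeff (z : EuclideanSpace ℝ (Fin d)) {X : Space d} (hX : 0 < radSq X) :
    HasFDerivAt (tangCoeff a z) (dotCLM (gradTang a z X)) X := by
  exact ((hasFDerivAt_radDist _ _ z hX).const_mul _).congr_fderiv (dotCLM_smul _ _).symm

theorem hasFDerivAt_normCoeff (z : EuclideanSpace ℝ (Fin d)) {X : Space d} (hX : 0 < radSq X) :
    HasFDerivAt (normCoeff a z) (dotCLM (gradNorm a z X)) X := by
  refine (((hasFDerivAt_radDist _ _ z hX).const_mul _).add
    (hasFDerivAt_tangCoeff z hX)).congr_fderiv ?_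
  rw [gradNorm, dotCLM_add, dotCLM_smul]

/-- The equation `L_a K = 0` off the thin set, in non-divergence form:
`ΔK + (a / y) ∂_y K = 0`. -/
theorem laplacian_kernel_eq (z : EuclideanSpace ℝ (Fin d)) {X : Space d} (hX : 0 < radSq X) :
    (∑ i, (tangCoeff a z X + (gradTang a z X).1 i * (X.1 i - z i)))
      + (normCoeff a z X + (gradNorm a z X).2.1 * X.2.1)
      + (normCoeff a z X + (gradNorm a z X).2.2 * X.2.2) + a * normCoeff a z X = 0 := by
  have hq : 0 < distSq z X := hX.trans_le (radSq_le_distSq z X)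
  have hsum : ∑ i, (X.1 i - z i) * (X.1 i - z i) = distSq z X - radSq X := by
    have : distSq z X - radSq X = ‖X.1 - z‖ ^ 2 := by unfold distSq; ring
    rw [this, EuclideanSpace.norm_sq_eq]
    simp [pow_two]
  have hs : X.2.1 * X.2.1 + X.2.2 * X.2.2 = radSq X := by unfold radSq; ring
  have e1 : (∑ i, (tangCoeff a z X + (gradTang a z X).1 i * (X.1 i - z i)))
      = d * tangCoeff a z X + 2 * (-((d : ℝ) - a) / 2) * (2 * (-((d : ℝ) - a) / 2 - 1)
        * radDist (-a / 2) (-((d : ℝ) - a) / 2 - 1 - 1) z X) * (distSq z X - radSq X) := by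
    rw [← hsum, Finset.sum_add_distrib, Finset.mul_sum]
    simp [gradTang, gradRadDist, mul_assoc]
  have e2 : (gradNorm a z X).2.1 * X.2.1 + (gradNorm a z X).2.2 * X.2.2
      = (2 * (-a / 2) * (2 * (-a / 2 - 1) * radDist (-a / 2 - 1 - 1) (-((d : ℝ) - a) / 2) z X
          + 2 * (-((d : ℝ) - a) / 2) * radDist (-a / 2 - 1) (-((d : ℝ) - a) / 2 - 1) z X)
        + 2 * (-((d : ℝ) - a) / 2) * (2 * (-a / 2)
            * radDist (-a / 2 - 1) (-((d : ℝ) - a) / 2 - 1) z X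
          + 2 * (-((d : ℝ) - a) / 2 - 1)
            * radDist (-a / 2) (-((d : ℝ) - a) / 2 - 1 - 1) z X)) * radSq X := by
    rw [← hs]
    simp only [gradNorm, gradTang, gradRadDist, Prod.snd_add, Prod.fst_add, Prod.smul_snd,
      Prod.smul_fst, smul_eq_mul]
    ring
  -- Since ∂_y K is `normCoeff` times y, the singular term (a/y) ∂_y K is a times `normCoeff` and
  -- stays regular across y = 0.
  have e3 : (∑ i, (tangCoeff a z X + (gradTang a z X).1 i * (X.1 i - z i)))
      + (normCoeff a z X + (gradNorm a z X).2.1 * X.2.1)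
      + (normCoeff a z X + (gradNorm a z X).2.2 * X.2.2) + a * normCoeff a z X
      = (∑ i, (tangCoeff a z X + (gradTang a z X).1 i * (X.1 i - z i)))
      + ((gradNorm a z X).2.1 * X.2.1 + (gradNorm a z X).2.2 * X.2.2)
      + (2 + a) * normCoeff a z X := by ring
  rw [e3, e1, e2]
  simp only [normCoeff, tangCoeff, radDist]
  generalize distSq z X = q at *
  generalize radSq X = ρ at *
  -- In terms of p and r one has a = -2p and d = -2r - 2p. With ρ^(p-2) and q^(r-2) as the lowest
  -- powers, what remains is a polynomial identity.
  set p := -a / 2 with hp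
  set r := -((d : ℝ) - a) / 2 with hr
  have p1 : ρ ^ p = ρ ^ (p - 1) * ρ := by
    rw [Real.rpow_sub_one hX.ne']; field_simp
  have p2 : ρ ^ (p - 1) = ρ ^ (p - 1 - 1) * ρ := by
    rw [Real.rpow_sub_one hX.ne' (p - 1)]; field_simp
  have r1 : q ^ r = q ^ (r - 1) * q := by
    rw [Real.rpow_sub_one hq.ne']; field_simp
  have r2 : q ^ (r - 1) = q ^ (r - 1 - 1) * q := by
    rw [Real.rpow_sub_one hq.ne' (r - 1)]; field_simp
  have hd : (d : ℝ) = -2 * r - 2 * p := by rw [hp, hr]; ring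
  have ha : a = -2 * p := by rw [hp]; ring
  rw [p1, p2, r1, r2, hd, ha]
  ring

theorem clm_apply_eq_sum (L : Space d →L[ℝ] ℝ) (P : Space d) :
    L P = (∑ i, P.1 i * L (EuclideanSpace.single i 1, 0, 0)) + P.2.1 * L (0, 1, 0)
      + P.2.2 * L (0, 0, 1) := by
  have hP : P = (∑ i, P.1 i • ((EuclideanSpace.single i 1, 0, 0) : Space d))
      + P.2.1 • ((0, 1, 0) : Space d) + P.2.2 • ((0, 0, 1) : Space d) := by
    have h1 : P.1 = ∑ i, P.1 i • EuclideanSpace.single i (1 : ℝ) := by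
      ext j
      simp [Finset.sum_apply, Pi.single_apply]
    ext1
    · simpa [Prod.fst_sum] using h1
    · ext1 <;> simp [Prod.snd_sum]
  conv_lhs => rw [hP]
  simp only [map_add, map_sum, map_smul, smul_eq_mul]

theorem IsTest.integrable_mul {Ω : Set (Space d)} {φ : Space d → ℝ} (hφ : IsTest Ω φ)
    {f : Space d → ℝ} (hf : ContinuousOn f Ω) : Integrable fun X => f X * φ X := by
  refine (integrableOn_iff_integrable_of_support_subset
    ((Function.support_mul_subset_right _ _).trans (subset_tsupport φ))).1 ?_
  exact ((hf.mono hφ.2.2).mul hφ.1.continuous.continuousOn).integrableOn_compact hφ.2.1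

theorem IsTest.fderiv_apply {Ω : Set (Space d)} {φ : Space d → ℝ} (hφ : IsTest Ω φ)
    (e : Space d) : IsTest Ω fun X => fderiv ℝ φ X e :=
  ⟨(hφ.1.fderiv_right (m := ∞) (by simp)).clm_apply contDiff_const,
    hφ.2.1.fderiv_apply (𝕜 := ℝ) e, (tsupport_fderiv_apply_subset ℝ e).trans hφ.2.2⟩

theorem IsTest.integral_mul_fderiv {Ω : Set (Space d)} {φ : Space d → ℝ} (hφ : IsTest Ω φ)
    {f f' : Space d → ℝ} {e : Space d} (hf : ContinuousOn f Ω) (hf' : ContinuousOn f' Ω)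
    (hd : ∀ X ∈ Ω, HasLineDerivAt ℝ f (f' X) X e) :
    ∫ X, f X * fderiv ℝ φ X e = - ∫ X, f' X * φ X :=
  integral_bilinear_hasLineDerivAt_right_eq_neg_left_of_integrable
    (B := ContinuousLinearMap.mul ℝ ℝ) (hφ.integrable_mul hf')
    ((hφ.fderiv_apply e).integrable_mul hf) (hφ.integrable_mul hf)
    (fun X hX => hd X (hφ.2.2 hX))
    (fun X _ => ((hφ.1.differentiable (by simp) X).hasFDerivAt).hasLineDerivAt e)

/-- |y|^a is singular on y = 0, which test functions may meet; (y² + δ)^{a/2} is smooth and permits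
integration by parts across that hyperplane. -/
theorem hasLineDerivAt_regWeight {δ : ℝ} (hδ : 0 < δ) (X e : Space d) :
    HasLineDerivAt ℝ (fun X : Space d => (X.2.2 ^ 2 + δ) ^ (a / 2))
      (e.2.2 * (a * X.2.2 * (X.2.2 ^ 2 + δ) ^ (a / 2 - 1))) X e := by
  have h0 : X.2.2 ^ 2 + δ ≠ 0 := by positivity
  have h := (((hasFDerivAt_snd (𝕜 := ℝ) (p := X)).snd.pow 2).add_const δ).rpow_const
    (p := a / 2) (Or.inl h0)
  refine HasDerivAt.congr_deriv (h.hasLineDerivAt e) ?_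
  simp
  ring

theorem dotCLM_single (P : Space d) (i : Fin d) :
    dotCLM P (EuclideanSpace.single i 1, 0, 0) = P.1 i := by
  simp [dotCLM_apply, dot, EuclideanSpace.inner_single_left]

theorem dotCLM_e_n (P : Space d) : dotCLM P (0, 1, 0) = P.2.1 := by simp [dotCLM_apply, dot]

theorem dotCLM_e_y (P : Space d) : dotCLM P (0, 0, 1) = P.2.2 := by simp [dotCLM_apply, dot]

theorem HasLineDerivAt.mul {E : Type*} [AddCommGroup E] [Module ℝ E] {f g : E → ℝ} {f' g' : ℝ}
    {x e : E} (hf : HasLineDerivAt ℝ f f' x e) (hg : HasLineDerivAt ℝ g g' x e) :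
    HasLineDerivAt ℝ (fun y => f y * g y) (f' * g x + f x * g') x e := by
  refine HasDerivAt.congr_deriv (HasDerivAt.mul hf hg) ?_
  simp

theorem continuousOn_radDist (p r : ℝ) (z : EuclideanSpace ℝ (Fin d)) :
    ContinuousOn (radDist p r z) (thinSet d)ᶜ := fun X hX =>
  ((continuousAt_radDist (P := (X, z)) (mem_compl_thinSet_iff.1 hX)).comp
    (f := fun Y : Space d => (Y, z)) (by fun_prop)).continuousWithinAt

theorem continuousOn_gradRadDist (p r : ℝ) (z : EuclideanSpace ℝ (Fin d)) :
    ContinuousOn (gradRadDist p r z) (thinSet d)ᶜ := fun X hX =>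
  ((continuousAt_gradRadDist (P := (X, z)) (mem_compl_thinSet_iff.1 hX)).comp
    (f := fun Y : Space d => (Y, z)) (by fun_prop)).continuousWithinAt

theorem continuousOn_tangCoeff (z : EuclideanSpace ℝ (Fin d)) :
    ContinuousOn (tangCoeff a z) (thinSet d)ᶜ :=
  continuousOn_const.mul (continuousOn_radDist _ _ z)

theorem continuousOn_normCoeff (z : EuclideanSpace ℝ (Fin d)) :
    ContinuousOn (normCoeff a z) (thinSet d)ᶜ :=
  (continuousOn_const.mul (continuousOn_radDist _ _ z)).add (continuousOn_tangCoeff z)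

theorem continuousOn_gradTang (z : EuclideanSpace ℝ (Fin d)) :
    ContinuousOn (gradTang a z) (thinSet d)ᶜ := by
  have h := continuousOn_gradRadDist (-a / 2) (-((d : ℝ) - a) / 2 - 1) z
  exact h.const_smul (2 * (-((d : ℝ) - a) / 2))

theorem continuousOn_gradNorm (z : EuclideanSpace ℝ (Fin d)) :
    ContinuousOn (gradNorm a z) (thinSet d)ᶜ := by
  have h := continuousOn_gradRadDist (-a / 2 - 1) (-((d : ℝ) - a) / 2) z
  exact (h.const_smul (2 * (-a / 2))).add (continuousOn_gradTang z)

theorem integral_sum_add_add {α ι : Type*} [MeasurableSpace α] {μ : Measure α} [Fintype ι]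
    {f : ι → α → ℝ} {g h : α → ℝ} (hf : ∀ i, Integrable (f i) μ) (hg : Integrable g μ)
    (hh : Integrable h μ) :
    ∫ x, ((∑ i, f i x) + g x + h x) ∂μ = (∑ i, ∫ x, f i x ∂μ) + ∫ x, g x ∂μ + ∫ x, h x ∂μ := by
  have hs : Integrable (fun x => ∑ i, f i x) μ := integrable_finsetSum _ fun i _ => hf i
  have h1 : ∫ x, ((∑ i, f i x) + g x + h x) ∂μ
      = ∫ x, ((∑ i, f i x) + g x) ∂μ + ∫ x, h x ∂μ := integral_add (hs.add hg) hh
  have h2 : ∫ x, ((∑ i, f i x) + g x) ∂μ = ∫ x, (∑ i, f i x) ∂μ + ∫ x, g x ∂μ :=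
    integral_add hs hg
  rw [h1, h2, integral_finsetSum _ fun i _ => hf i]

/-- Integration by parts of the Poisson kernel against the regularized weight `(y² + δ)^{a/2}`. -/
theorem integral_regWeight_mul_fderiv_gradKernel (z : EuclideanSpace ℝ (Fin d))
    {φ : Space d → ℝ} (hφ : IsTest (thinSet d)ᶜ φ) {δ : ℝ} (hδ : 0 < δ) :
    ∫ X : Space d, (X.2.2 ^ 2 + δ) ^ (a / 2) * fderiv ℝ φ X (gradKernel a z X)
      = ∫ X : Space d, a * normCoeff a z X * (δ * (X.2.2 ^ 2 + δ) ^ (a / 2 - 1)) * φ X := by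
  have hpos : ∀ X : Space d, 0 < X.2.2 ^ 2 + δ := fun X => by positivity
  have hw : ∀ p : ℝ, Continuous fun X : Space d => (X.2.2 ^ 2 + δ) ^ p := fun p =>
    Continuous.rpow_const (by fun_prop) fun X => Or.inl (hpos X).ne'
  have ht := continuousOn_tangCoeff (a := a) z
  have hn := continuousOn_normCoeff (a := a) z
  have hgt := continuousOn_gradTang (a := a) z
  have hgn := continuousOn_gradNorm (a := a) z
  have hwo := fun p => (hw p).continuousOn (s := (thinSet d)ᶜ)
  set w : Space d → ℝ := fun X => (X.2.2 ^ 2 + δ) ^ (a / 2) with hwdef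
  have cx : ∀ i, Continuous fun X : Space d => X.1 i - z i := fun i => by fun_prop
  have cs : Continuous fun X : Space d => X.2.1 := by fun_prop
  have cy : Continuous fun X : Space d => X.2.2 := by fun_prop
  have cf1 : ∀ i, ContinuousOn (fun X => w X * (tangCoeff a z X * (X.1 i - z i))) (thinSet d)ᶜ :=
    fun i => (hwo _).mul (ht.mul (cx i).continuousOn)
  have cf1' : ∀ i, ContinuousOn (fun X => w X * (tangCoeff a z X
      + (gradTang a z X).1 i * (X.1 i - z i))) (thinSet d)ᶜ := fun i =>
    (hwo _).mul (ht.add (ContinuousOn.mul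
      (Continuous.comp_continuousOn (g := fun P : Space d => P.1 i) (by fun_prop) hgt)
      (cx i).continuousOn))
  have cf2 : ContinuousOn (fun X => w X * (normCoeff a z X * X.2.1)) (thinSet d)ᶜ :=
    (hwo _).mul (hn.mul cs.continuousOn)
  have cf2' : ContinuousOn (fun X => w X * (normCoeff a z X + (gradNorm a z X).2.1 * X.2.1))
      (thinSet d)ᶜ :=
    (hwo _).mul (hn.add (hgn.snd.fst.mul cs.continuousOn))
  have cf3 : ContinuousOn (fun X => w X * (normCoeff a z X * X.2.2)) (thinSet d)ᶜ :=
    (hwo _).mul (hn.mul cy.continuousOn)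
  have cf3' : ContinuousOn (fun X => w X * (normCoeff a z X + (gradNorm a z X).2.2 * X.2.2)
      + a * X.2.2 * (X.2.2 ^ 2 + δ) ^ (a / 2 - 1) * (normCoeff a z X * X.2.2)) (thinSet d)ᶜ :=
    ((hwo _).mul (hn.add (hgn.snd.snd.mul cy.continuousOn))).add
      (((continuousOn_const.mul cy.continuousOn).mul (hwo _)).mul (hn.mul cy.continuousOn))
  have i1 : ∀ i, ∫ X, w X * (tangCoeff a z X * (X.1 i - z i))
      * fderiv ℝ φ X (EuclideanSpace.single i 1, 0, 0)
      = - ∫ X, w X * (tangCoeff a z X + (gradTang a z X).1 i * (X.1 i - z i)) * φ X := by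
    intro i
    refine hφ.integral_mul_fderiv (cf1 i) (cf1' i) fun X hX => ?_
    have hX' := mem_compl_thinSet_iff.1 hX
    have h1 := hasLineDerivAt_regWeight (a := a) hδ X (EuclideanSpace.single i 1, 0, 0)
    have h2 := (hasFDerivAt_tangCoeff (a := a) z hX').hasLineDerivAt
      (EuclideanSpace.single i 1, 0, 0)
    have h3 : HasLineDerivAt ℝ (fun X : Space d => X.1 i - z i) 1 X
        (EuclideanSpace.single i 1, 0, 0) := by
      have : HasDerivAt (fun t : ℝ => X.1 i + t * 1 - z i) (1 * 1) 0 :=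
        (((hasDerivAt_id 0).mul_const 1).const_add _).sub_const _
      simpa [HasLineDerivAt] using this
    refine HasDerivAt.congr_deriv (HasLineDerivAt.mul h1 (HasLineDerivAt.mul h2 h3)) ?_
    simp only [dotCLM_single, w]
    ring
  have i2 : ∫ X, w X * (normCoeff a z X * X.2.1) * fderiv ℝ φ X (0, 1, 0)
      = - ∫ X, w X * (normCoeff a z X + (gradNorm a z X).2.1 * X.2.1) * φ X := by
    refine hφ.integral_mul_fderiv cf2 cf2' fun X hX => ?_
    have hX' := mem_compl_thinSet_iff.1 hX
    have h1 := hasLineDerivAt_regWeight (a := a) hδ X (0, 1, 0)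
    have h2 := (hasFDerivAt_normCoeff (a := a) z hX').hasLineDerivAt (0, 1, 0)
    have h3 : HasLineDerivAt ℝ (fun X : Space d => X.2.1) 1 X (0, 1, 0) := by
      have : HasDerivAt (fun t : ℝ => X.2.1 + t * 1) (1 * 1) 0 :=
        ((hasDerivAt_id 0).mul_const 1).const_add _
      simpa [HasLineDerivAt] using this
    refine HasDerivAt.congr_deriv (HasLineDerivAt.mul h1 (HasLineDerivAt.mul h2 h3)) ?_
    simp only [dotCLM_e_n, w]
    ring
  have i3 : ∫ X, w X * (normCoeff a z X * X.2.2) * fderiv ℝ φ X (0, 0, 1)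
      = - ∫ X, (w X * (normCoeff a z X + (gradNorm a z X).2.2 * X.2.2)
        + a * X.2.2 * (X.2.2 ^ 2 + δ) ^ (a / 2 - 1) * (normCoeff a z X * X.2.2)) * φ X := by
    refine hφ.integral_mul_fderiv cf3 cf3' fun X hX => ?_
    have hX' := mem_compl_thinSet_iff.1 hX
    have h1 := hasLineDerivAt_regWeight (a := a) hδ X (0, 0, 1)
    have h2 := (hasFDerivAt_normCoeff (a := a) z hX').hasLineDerivAt (0, 0, 1)
    have h3 : HasLineDerivAt ℝ (fun X : Space d => X.2.2) 1 X (0, 0, 1) := by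
      have : HasDerivAt (fun t : ℝ => X.2.2 + t * 1) (1 * 1) 0 :=
        ((hasDerivAt_id 0).mul_const 1).const_add _
      simpa [HasLineDerivAt] using this
    refine HasDerivAt.congr_deriv (HasLineDerivAt.mul h1 (HasLineDerivAt.mul h2 h3)) ?_
    simp only [dotCLM_e_y, w]
    ring
  have hsplit : ∀ X, w X * fderiv ℝ φ X (gradKernel a z X)
      = (∑ i, w X * (tangCoeff a z X * (X.1 i - z i))
          * fderiv ℝ φ X (EuclideanSpace.single i 1, 0, 0))
        + w X * (normCoeff a z X * X.2.1) * fderiv ℝ φ X (0, 1, 0)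
        + w X * (normCoeff a z X * X.2.2) * fderiv ℝ φ X (0, 0, 1) := by
    intro X
    rw [clm_apply_eq_sum, gradKernel_eq, mul_add, mul_add, Finset.mul_sum]
    simp [mul_assoc]
  change ∫ X, w X * fderiv ℝ φ X (gradKernel a z X) = _
  simp only [hsplit]
  have j1 : ∀ i, Integrable fun X => w X * (tangCoeff a z X * (X.1 i - z i))
      * fderiv ℝ φ X (EuclideanSpace.single i 1, 0, 0) := fun i =>
    (hφ.fderiv_apply _).integrable_mul (cf1 i)
  have j2 := (hφ.fderiv_apply (0, 1, 0)).integrable_mul cf2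
  have j3 := (hφ.fderiv_apply (0, 0, 1)).integrable_mul cf3
  have j1' := fun i => hφ.integrable_mul (cf1' i)
  have j2' := hφ.integrable_mul cf2'
  have j3' := hφ.integrable_mul cf3'
  rw [integral_sum_add_add j1 j2 j3]
  simp only [i1, i2, i3]
  rw [Finset.sum_neg_distrib, ← neg_add, ← neg_add, ← integral_sum_add_add j1' j2' j3',
    ← integral_neg]
  refine integral_congr_ae (Eventually.of_forall fun X => ?_)
  simp only
  by_cases hX : X ∈ tsupport φ
  · have hX' := mem_compl_thinSet_iff.1 (hφ.2.2 hX)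
    have hlap := laplacian_kernel_eq (a := a) z hX'
    -- The weight's derivative contributes a y² (y² + δ)^{a/2-1} `normCoeff`. Writing y² = (y² + δ)
    -- - δ, the first part cancels through the equation and the δ part is the right-hand side.
    have hwX : w X = (X.2.2 ^ 2 + δ) ^ (a / 2 - 1) * (X.2.2 ^ 2 + δ) := by
      rw [Real.rpow_sub_one (hpos X).ne', div_mul_cancel₀ _ (hpos X).ne']
    rw [← Finset.sum_mul, ← Finset.mul_sum]
    have : ∑ i, (tangCoeff a z X + (gradTang a z X).1 i * (X.1 i - z i))
        = -(normCoeff a z X + (gradNorm a z X).2.1 * X.2.1)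
          - (normCoeff a z X + (gradNorm a z X).2.2 * X.2.2) - a * normCoeff a z X := by
      linarith
    rw [this, hwX]
    ring
  · simp [image_eq_zero_of_notMem_tsupport hX]

/-- The Poisson kernel is a weak solution off the thin set. -/
theorem integral_weight_mul_fderiv_gradKernel (ha : a ∈ Ioo (-1 : ℝ) 0)
    (z : EuclideanSpace ℝ (Fin d)) {φ : Space d → ℝ} (hφ : IsTest (thinSet d)ᶜ φ) :
    ∫ X : Space d, |X.2.2| ^ a * fderiv ℝ φ X (gradKernel a z X) = 0 := by
  set δ : ℕ → ℝ := fun k => 1 / ((k : ℝ) + 1)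
  have hδ : ∀ k, 0 < δ k := fun k => by positivity
  have hδ0 : Tendsto δ atTop (𝓝 0) := tendsto_one_div_add_atTop_nhds_zero_nat
  have hpos : ∀ k (X : Space d), 0 < X.2.2 ^ 2 + δ k := fun k X => by have := hδ k; positivity
  have hwle : ∀ k (X : Space d), X.2.2 ≠ 0 → (X.2.2 ^ 2 + δ k) ^ (a / 2) ≤ |X.2.2| ^ a := by
    intro k X hy
    have h1 : |X.2.2| ^ a = (X.2.2 ^ 2) ^ (a / 2) := by
      rw [← sq_abs, ← Real.rpow_natCast, ← Real.rpow_mul (abs_nonneg _)]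
      congr 1
      push_cast
      ring
    rw [h1]
    exact Real.rpow_le_rpow_of_nonpos (by positivity) (by linarith [hδ k]) (by linarith [ha.2])
  have hwc : ∀ k, Continuous fun X : Space d => (X.2.2 ^ 2 + δ k) ^ (a / 2) := fun k =>
    Continuous.rpow_const (by fun_prop) fun X => Or.inl (hpos k X).ne'
  have hwc' : ∀ k, Continuous fun X : Space d => (X.2.2 ^ 2 + δ k) ^ (a / 2 - 1) := fun k =>
    Continuous.rpow_const (by fun_prop) fun X => Or.inl (hpos k X).ne'
  have hwi := locallyIntegrable_weight (d := d) ha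
  have hint : ∀ {h : Space d → ℝ}, ContinuousOn h (thinSet d)ᶜ → Function.support h ⊆ tsupport φ →
      Integrable fun X : Space d => |X.2.2| ^ a * h X := by
    intro h hh hs
    refine (integrableOn_iff_integrable_of_support_subset
      ((Function.support_mul_subset_right _ _).trans hs)).1 ?_
    exact (hwi.integrableOn_isCompact hφ.2.1).mul_continuousOn (hh.mono hφ.2.2) hφ.2.1
  have hc1 : ContinuousOn (fun X => fderiv ℝ φ X (gradKernel a z X)) (thinSet d)ᶜ :=
    (hφ.1.continuous_fderiv (by simp)).continuousOn.clm_apply (continuousOn_gradRadDist _ _ z)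
  have hs1 : Function.support (fun X => fderiv ℝ φ X (gradKernel a z X)) ⊆ tsupport φ := by
    intro X hX
    refine support_fderiv_subset ℝ (fun h0 => hX ?_)
    simp [h0]
  have hc2 : ContinuousOn (fun X => a * normCoeff a z X * φ X) (thinSet d)ᶜ :=
    (continuousOn_const.mul (continuousOn_normCoeff z)).mul hφ.1.continuous.continuousOn
  have hs2 : Function.support (fun X => a * normCoeff a z X * φ X) ⊆ tsupport φ :=
    (Function.support_mul_subset_right _ _).trans (subset_tsupport φ)
  have habs : ∀ X : Space d, X.2.2 ≠ 0 → (X.2.2 ^ 2 + 0) ^ (a / 2) = |X.2.2| ^ a := by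
    intro X hy
    rw [add_zero, ← sq_abs, ← Real.rpow_natCast, ← Real.rpow_mul (abs_nonneg _)]
    congr 1
    push_cast
    ring
  -- The weight is nonzero almost everywhere, so dividing by it recovers measurability of h.
  have hsmeas : ∀ {h : Space d → ℝ}, Integrable (fun X : Space d => |X.2.2| ^ a * h X) →
      AEStronglyMeasurable h volume := by
    intro h hh
    refine AEStronglyMeasurable.congr (f := fun X : Space d => (|X.2.2| ^ a)⁻¹
      * (|X.2.2| ^ a * h X)) (measurable_weight.inv.aestronglyMeasurable.mul hh.1) ?_
    filter_upwards [ae_y_ne_zero (d := d)] with X hy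
    have : |X.2.2| ^ a ≠ 0 := (Real.rpow_pos_of_pos (abs_pos.2 hy) _).ne'
    field_simp
  have lim1 : Tendsto (fun k => ∫ X : Space d, (X.2.2 ^ 2 + δ k) ^ (a / 2)
      * fderiv ℝ φ X (gradKernel a z X)) atTop
      (𝓝 (∫ X : Space d, |X.2.2| ^ a * fderiv ℝ φ X (gradKernel a z X))) := by
    refine tendsto_integral_of_dominated_convergence _ (fun k => ?_) (hint hc1 hs1).norm
      (fun k => ?_) ?_
    · exact (hwc k).aestronglyMeasurable.mul (hsmeas (hint hc1 hs1))
    · filter_upwards [ae_y_ne_zero (d := d)] with X hy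
      rw [norm_mul, norm_mul, Real.norm_of_nonneg (Real.rpow_nonneg (hpos k X).le _),
        Real.norm_of_nonneg (Real.rpow_nonneg (abs_nonneg X.2.2) a)]
      exact mul_le_mul_of_nonneg_right (hwle k X hy) (norm_nonneg _)
    · filter_upwards [ae_y_ne_zero (d := d)] with X hy
      refine Tendsto.mul_const _ ?_
      rw [← habs X hy]
      exact (tendsto_const_nhds.add hδ0).rpow_const (Or.inl (by positivity))
  -- The remainder weight satisfies δ (y² + δ)^{a/2-1} ≤ (y² + δ)^{a/2} ≤ |y|^a and tends to zero
  -- wherever y ≠ 0, so the same dominating function serves both limits.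
  have lim2 : Tendsto (fun k => ∫ X : Space d, a * normCoeff a z X
      * (δ k * (X.2.2 ^ 2 + δ k) ^ (a / 2 - 1)) * φ X) atTop (𝓝 (∫ X : Space d, (0 : ℝ))) := by
    refine tendsto_integral_of_dominated_convergence _ (fun k => ?_) (hint hc2 hs2).norm
      (fun k => ?_) ?_
    · have h1 := (hsmeas (hint hc2 hs2)).mul
        ((hwc' k).const_mul (δ k)).aestronglyMeasurable
      refine h1.congr (Eventually.of_forall fun X => ?_)
      simp only [Pi.mul_apply]
      ring
    · filter_upwards [ae_y_ne_zero (d := d)] with X hy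
      have h1 : a * normCoeff a z X * (δ k * (X.2.2 ^ 2 + δ k) ^ (a / 2 - 1)) * φ X
          = δ k * (X.2.2 ^ 2 + δ k) ^ (a / 2 - 1) * (a * normCoeff a z X * φ X) := by ring
      have h2 : δ k * (X.2.2 ^ 2 + δ k) ^ (a / 2 - 1) ≤ |X.2.2| ^ a := by
        refine le_trans ?_ (hwle k X hy)
        rw [Real.rpow_sub_one (hpos k X).ne', mul_div_assoc', div_le_iff₀ (hpos k X), mul_comm]
        gcongr
        linarith [sq_nonneg X.2.2]
      have h3 : 0 ≤ δ k * (X.2.2 ^ 2 + δ k) ^ (a / 2 - 1) :=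
        mul_nonneg (hδ k).le (Real.rpow_nonneg (hpos k X).le _)
      rw [h1, norm_mul _ (a * normCoeff a z X * φ X), norm_mul _ (a * normCoeff a z X * φ X),
        Real.norm_of_nonneg h3, Real.norm_of_nonneg (Real.rpow_nonneg (abs_nonneg X.2.2) a)]
      exact mul_le_mul_of_nonneg_right h2 (norm_nonneg _)
    · filter_upwards [ae_y_ne_zero (d := d)] with X hy
      have h1 : Tendsto (fun k => δ k * (X.2.2 ^ 2 + δ k) ^ (a / 2 - 1)) atTop
          (𝓝 (0 * (X.2.2 ^ 2 + 0) ^ (a / 2 - 1))) :=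
        hδ0.mul ((tendsto_const_nhds.add hδ0).rpow_const (Or.inl (by positivity)))
      have h2 := (h1.const_mul (a * normCoeff a z X)).mul_const (φ X)
      simpa using h2
  simp only [integral_regWeight_mul_fderiv_gradKernel z hφ (hδ _)] at lim1
  rw [tendsto_nhds_unique lim1 lim2, integral_zero]

/-! ### The Poisson extension: continuity, equation, decay -/

/-- The unnormalized Poisson profile `(1 + |z|²)^{-(d - a) / 2}`. -/
def profile (a : ℝ) (z : EuclideanSpace ℝ (Fin d)) : ℝ :=
  (1 + ‖z‖ ^ 2) ^ (-((d : ℝ) - a) / 2)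

theorem profile_pos (a : ℝ) (z : EuclideanSpace ℝ (Fin d)) : 0 < profile a z := by
  unfold profile
  positivity

theorem continuous_profile : Continuous (profile (d := d) a) :=
  Continuous.rpow_const (by fun_prop) fun z => Or.inl (by positivity)

theorem integrable_profile (ha : a < 0) : Integrable (profile (d := d) a) :=
  integrable_rpow_neg_one_add_norm_sq (by simp; linarith)

/-- The mass of the Poisson profile. -/
def profileMass (d : ℕ) (a : ℝ) : ℝ := ∫ z : EuclideanSpace ℝ (Fin d), profile a z

theorem profileMass_pos (ha : a < 0) : 0 < profileMass d a := by
  refine (integral_pos_iff_support_of_nonneg (fun z => (profile_pos a z).le)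
    (integrable_profile ha)).2 ?_
  have : Function.support (profile (d := d) a) = univ :=
    eq_univ_of_forall fun z => (profile_pos a z).ne'
  rw [this]
  exact Measure.measure_univ_pos.2 (NeZero.ne _)

/-- The `a`-harmonic extension of `v`, given by Poisson's formula in scaled variables. -/
def poissonExt (a : ℝ) (v : EuclideanSpace ℝ (Fin d) → ℝ) (X : Space d) : ℝ :=
  (profileMass d a)⁻¹ * ∫ z, profile a z * v (X.1 - √(radSq X) • z)

theorem exists_abs_le_of_tendsto_cocompact {E : Type*} [TopologicalSpace E] {v : E → ℝ}
    (hv : Continuous v) (h0 : Tendsto v (cocompact E) (𝓝 0)) : ∃ B, 0 ≤ B ∧ ∀ z, |v z| ≤ B := by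
  obtain ⟨t, ht, hsub⟩ := mem_cocompact.1 (h0.eventually (Metric.ball_mem_nhds 0 one_pos))
  obtain ⟨C, hC⟩ := ht.exists_bound_of_continuousOn hv.continuousOn
  refine ⟨max C 1, by positivity, fun z => ?_⟩
  by_cases hz : z ∈ t
  · exact (hC z hz).trans (le_max_left _ _)
  · have := hsub hz
    simp only [dist_zero_right, mem_ofPred_eq, Real.norm_eq_abs] at this
    exact this.le.trans (le_max_right _ _)

/-- In scaled variables the density is fixed and X enters only through the argument of v, so
dominated convergence reaches the thin set as well. -/
theorem continuous_poissonExt (ha : a < 0) {v : EuclideanSpace ℝ (Fin d) → ℝ} (hv : Continuous v)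
    {B : ℝ} (hB : ∀ z, |v z| ≤ B) : Continuous (poissonExt a v) := by
  refine continuous_const.mul (continuous_of_dominated (bound := fun z => profile a z * B)
    (fun X => ?_) (fun X => Eventually.of_forall fun z => ?_)
    ((integrable_profile ha).mul_const B) (Eventually.of_forall fun z => ?_))
  · exact (continuous_profile.mul (hv.comp (by fun_prop))).aestronglyMeasurable
  · rw [norm_mul, Real.norm_of_nonneg (profile_pos a z).le]
    exact mul_le_mul_of_nonneg_left (hB _) (profile_pos a z).le
  · have := continuous_radSq (d := d)
    fun_prop

theorem poissonExt_of_radSq_eq_zero (ha : a < 0) (v : EuclideanSpace ℝ (Fin d) → ℝ) {X : Space d}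
    (hX : radSq X = 0) : poissonExt a v X = v X.1 := by
  simp only [poissonExt, hX, Real.sqrt_zero, zero_smul, sub_zero]
  rw [integral_mul_const, ← mul_assoc]
  change (profileMass d a)⁻¹ * profileMass d a * _ = _
  rw [inv_mul_cancel₀ (profileMass_pos ha).ne', one_mul]

/-- Poisson's formula in the original variables. -/
theorem integral_profile_eq (v : EuclideanSpace ℝ (Fin d) → ℝ) {X : Space d}
    (hX : 0 < radSq X) :
    ∫ z, profile a z * v (X.1 - √(radSq X) • z) = ∫ z, poissonKernel a z X * v z := by
  set r := √(radSq X) with hr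
  have hr0 : 0 < r := Real.sqrt_pos.2 hX
  have hr2 : r ^ 2 = radSq X := Real.sq_sqrt hX.le
  have h1 : ∫ z, poissonKernel a z X * v z
      = ∫ u, poissonKernel a (X.1 - u) X * v (X.1 - u) :=
    (integral_sub_left_eq_self (fun z => poissonKernel a z X * v z) volume X.1).symm
  have h2 := Measure.integral_comp_smul (volume : Measure (EuclideanSpace ℝ (Fin d)))
    (fun u => poissonKernel a (X.1 - u) X * v (X.1 - u)) r
  have h3 : ∀ z, poissonKernel a (X.1 - r • z) X = (r ^ d)⁻¹ * profile a z := by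
    intro z
    have hq : distSq (X.1 - r • z) X = radSq X * (1 + ‖z‖ ^ 2) := by
      unfold distSq
      rw [sub_sub_cancel, norm_smul, Real.norm_of_nonneg hr0.le, mul_pow, hr2]
      ring
    -- The exponents add up to r^{-a} r^{-(d-a)} = r^{-d}, which cancels the Jacobian of z ↦ x' - r
    -- z.
    have hexp : (r ^ d)⁻¹ = radSq X ^ (-a / 2) * radSq X ^ (-((d : ℝ) - a) / 2) := by
      rw [← Real.rpow_add hX, ← hr2, ← Real.rpow_natCast r 2, ← Real.rpow_mul hr0.le,
        ← Real.rpow_natCast r d, ← Real.rpow_neg hr0.le]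
      congr 1
      push_cast
      ring
    rw [poissonKernel, radDist, hq, Real.mul_rpow hX.le (by positivity), hexp, profile]
    ring
  rw [h1]
  simp only [h3, finrank_euclideanSpace, Fintype.card_fin, smul_eq_mul, mul_assoc] at h2
  rw [integral_const_mul, abs_of_pos (by positivity)] at h2
  exact mul_left_cancel₀ (by positivity) h2

theorem poissonExt_eq (v : EuclideanSpace ℝ (Fin d) → ℝ) {X : Space d} (hX : 0 < radSq X) :
    poissonExt a v X = (profileMass d a)⁻¹ * ∫ z, poissonKernel a z X * v z := by
  rw [poissonExt, integral_profile_eq v hX]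

theorem integral_poissonKernel {X : Space d} (hX : 0 < radSq X) :
    ∫ z, poissonKernel a z X = profileMass d a := by
  have := integral_profile_eq (a := a) (fun _ => (1 : ℝ)) hX
  simpa only [mul_one, profileMass] using this.symm

theorem poissonKernel_nonneg (z : EuclideanSpace ℝ (Fin d)) (X : Space d) :
    0 ≤ poissonKernel a z X :=
  mul_nonneg (Real.rpow_nonneg (radSq_nonneg X) _)
    (Real.rpow_nonneg ((radSq_nonneg X).trans (radSq_le_distSq z X)) _)

/-- On compact sets off the thin set, the Poisson kernel and its gradient are dominated by the
profile. -/
theorem exists_kernel_le (ha : a < 0) {K : Set (Space d)} (hK : IsCompact K)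
    (hKΩ : K ⊆ (thinSet d)ᶜ) :
    ∃ C, 0 ≤ C ∧ ∀ X ∈ K, ∀ z, poissonKernel a z X ≤ C * profile a z ∧
      ‖gradKernel a z X‖ ≤ C * profile a z := by
  obtain ⟨r₀, hr₀, hle⟩ : ∃ r₀, 0 < r₀ ∧ ∀ X ∈ K, r₀ ≤ radSq X := by
    rcases K.eq_empty_or_nonempty with rfl | hne
    · exact ⟨1, one_pos, by simp⟩
    · obtain ⟨Y, hY, hmin⟩ := hK.exists_isMinOn hne continuous_radSq.continuousOn
      exact ⟨radSq Y, mem_compl_thinSet_iff.1 (hKΩ hY), fun X hX => hmin hX⟩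
  obtain ⟨R, hR⟩ := hK.isBounded.exists_norm_le
  obtain ⟨r₁, hr₁⟩ := hK.exists_bound_of_continuousOn continuous_radSq.continuousOn
  set m := ((d : ℝ) - a) / 2 with hm
  have hm0 : 0 < m := by
    have : (0 : ℝ) ≤ d := Nat.cast_nonneg d
    rw [hm]; linarith
  have hme : -((d : ℝ) - a) / 2 = -m := by rw [hm]; ring
  -- Chosen so that 1 + |z|² ≤ A (|x' - z|² + r²) for all X in K: the term 2 comes from |z|² ≤ 2|x'
  -- - z|² + 2R², and the rest from r² ≥ r₀.
  set A := 2 + (1 + 2 * R ^ 2) / r₀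
  have hA : 0 < A := by positivity
  set P₁ := |r₁| ^ (-a / 2)
  have hP₁ : 0 ≤ P₁ := by positivity
  set T := 2 * m * P₁ * A ^ m
  have hT : 0 ≤ T := by positivity
  set N := -a * P₁ * A ^ m / r₀ + T / r₀
  have hna : 0 < -a := by linarith
  have hN : 0 ≤ N := by positivity
  refine ⟨P₁ * A ^ m + T * (1 / r₀ + 1) + N * |R|, by positivity, fun X hX z => ?_⟩
  have hρ := hle X hX
  have hρ0 : 0 < radSq X := hr₀.trans_le hρ
  have hq0 : 0 < distSq z X := hρ0.trans_le (radSq_le_distSq z X)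
  have hρq := radSq_le_distSq z X
  have hXR := hR X hX
  have hb := profile_pos a z
  have hPle : radSq X ^ (-a / 2) ≤ P₁ := Real.rpow_le_rpow hρ0.le
    (((le_abs_self _).trans (hr₁ X hX)).trans (le_abs_self _)) (by linarith)
  have hP0 : 0 < radSq X ^ (-a / 2) := by positivity
  have hqz : (1 + ‖z‖ ^ 2) / A ≤ distSq z X := by
    rw [div_le_iff₀ hA]
    have h1 : ‖z‖ ≤ ‖X.1 - z‖ + ‖X.1‖ := by
      have := norm_sub_le X.1 (X.1 - z)
      rw [sub_sub_cancel] at this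
      linarith
    have h2 : ‖X.1‖ ≤ R := (norm_fst_le X).trans hXR
    have h3 : ‖z‖ ^ 2 ≤ 2 * ‖X.1 - z‖ ^ 2 + 2 * R ^ 2 := by
      have : ‖z‖ ^ 2 ≤ (‖X.1 - z‖ + R) ^ 2 := by gcongr; linarith
      nlinarith [sq_nonneg (‖X.1 - z‖ - R)]
    have h4 : 1 + 2 * R ^ 2 ≤ (1 + 2 * R ^ 2) / r₀ * distSq z X := by
      rw [div_mul_eq_mul_div, le_div_iff₀ hr₀]
      gcongr
      exact hρ.trans hρq
    have h5 : ‖X.1 - z‖ ^ 2 ≤ distSq z X := by unfold distSq; linarith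
    calc 1 + ‖z‖ ^ 2 ≤ 2 * distSq z X + (1 + 2 * R ^ 2) / r₀ * distSq z X := by linarith
      _ = _ := by ring
  set κ := distSq z X ^ (-m) with hκdef
  have hκ0 : 0 < κ := by positivity
  have hκ : κ ≤ A ^ m * profile a z := by
    have h1 : κ ≤ ((1 + ‖z‖ ^ 2) / A) ^ (-m) :=
      Real.rpow_le_rpow_of_nonpos (by positivity) hqz (by linarith)
    rw [Real.div_rpow (by positivity) hA.le, Real.rpow_neg hA.le, div_inv_eq_mul, mul_comm] at h1
    rwa [profile, hme]
  have hK : poissonKernel a z X ≤ P₁ * A ^ m * profile a z := by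
    rw [poissonKernel, radDist, hme, mul_assoc]
    exact mul_le_mul hPle hκ hκ0.le hP₁
  have htang : |tangCoeff a z X| ≤ T * profile a z / distSq z X := by
    rw [tangCoeff, radDist, hme, Real.rpow_sub_one hq0.ne', ← hκdef]
    have : 2 * -m * (radSq X ^ (-a / 2) * (κ / distSq z X))
        = -(2 * m * (radSq X ^ (-a / 2) * κ) / distSq z X) := by ring
    rw [this, abs_neg, abs_of_nonneg (by positivity)]
    refine div_le_div_of_nonneg_right ?_ hq0.le
    calc 2 * m * (radSq X ^ (-a / 2) * κ) ≤ 2 * m * (P₁ * (A ^ m * profile a z)) := by gcongr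
      _ = _ := by ring
  have htang' : |tangCoeff a z X| ≤ T / r₀ * profile a z := by
    refine htang.trans ?_
    rw [div_mul_eq_mul_div]
    gcongr
    exact hρ.trans hρq
  have hnorm : |normCoeff a z X| ≤ N * profile a z := by
    rw [normCoeff, add_mul]
    refine (abs_add_le _ _).trans (add_le_add ?_ htang')
    rw [radDist, hme, Real.rpow_sub_one hρ0.ne', ← hκdef]
    have : 2 * (-a / 2) * (radSq X ^ (-a / 2) / radSq X * κ)
        = -a * (radSq X ^ (-a / 2) * κ) / radSq X := by ring
    rw [this, abs_of_nonneg (by positivity), div_mul_eq_mul_div]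
    refine div_le_div₀ (by positivity) ?_ hr₀ hρ
    calc -a * (radSq X ^ (-a / 2) * κ) ≤ -a * (P₁ * (A ^ m * profile a z)) := by gcongr
      _ = _ := by ring
  -- The tangential coefficient carries an extra factor 1/`distSq`, which absorbs the growth of |x'
  -- - z|.
  have hx : ‖tangCoeff a z X • (X.1 - z)‖ ≤ T * (1 / r₀ + 1) * profile a z := by
    rw [norm_smul, Real.norm_eq_abs]
    have h1 : ‖X.1 - z‖ ≤ (1 / r₀ + 1) * distSq z X := by
      have h2 : 1 ≤ 1 / r₀ * distSq z X := by
        rw [one_div_mul_eq_div, one_le_div hr₀]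
        exact hρ.trans hρq
      have h3 : ‖X.1 - z‖ ^ 2 ≤ distSq z X := by unfold distSq; linarith
      nlinarith [sq_nonneg (‖X.1 - z‖ - 1)]
    calc |tangCoeff a z X| * ‖X.1 - z‖
        ≤ T * profile a z / distSq z X * ((1 / r₀ + 1) * distSq z X) := by gcongr
      _ = _ := by field_simp
  have hRabs : ‖X‖ ≤ |R| := hXR.trans (le_abs_self R)
  have hs : ‖normCoeff a z X * X.2.1‖ ≤ N * |R| * profile a z := by
    rw [norm_mul, Real.norm_eq_abs]
    calc |normCoeff a z X| * ‖X.2.1‖ ≤ N * profile a z * |R| := by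
          gcongr
          exact ((norm_fst_le X.2).trans (norm_snd_le X)).trans hRabs
      _ = _ := by ring
  have hy : ‖normCoeff a z X * X.2.2‖ ≤ N * |R| * profile a z := by
    rw [norm_mul, Real.norm_eq_abs]
    calc |normCoeff a z X| * ‖X.2.2‖ ≤ N * profile a z * |R| := by
          gcongr
          exact ((norm_snd_le X.2).trans (norm_snd_le X)).trans hRabs
      _ = _ := by ring
  have n1 : 0 ≤ P₁ * A ^ m * profile a z := by positivity
  have n2 : 0 ≤ T * (1 / r₀ + 1) * profile a z := by positivity
  have n3 : 0 ≤ N * |R| * profile a z := by positivity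
  have hexp : (P₁ * A ^ m + T * (1 / r₀ + 1) + N * |R|) * profile a z
      = P₁ * A ^ m * profile a z + T * (1 / r₀ + 1) * profile a z + N * |R| * profile a z := by
    ring
  rw [hexp, gradKernel_eq]
  refine ⟨by linarith, ?_⟩
  simp only [Prod.norm_def]
  refine max_le ?_ (max_le ?_ ?_) <;> linarith

theorem measurable_poissonKernel :
    Measurable fun p : Space d × EuclideanSpace ℝ (Fin d) => poissonKernel a p.2 p.1 := by
  unfold poissonKernel radDist
  exact ((continuous_radSq.comp continuous_fst).measurable.pow_const _).mul
    (continuous_distSq.measurable.pow_const _)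

theorem measurable_gradKernel :
    Measurable fun p : Space d × EuclideanSpace ℝ (Fin d) => gradKernel a p.2 p.1 := by
  have h : ∀ p r : ℝ, Measurable fun q : Space d × EuclideanSpace ℝ (Fin d) =>
      radDist p r q.2 q.1 := fun p r =>
    ((continuous_radSq.comp continuous_fst).measurable.pow_const _).mul
      (continuous_distSq.measurable.pow_const _)
  have h1 := (h (-a / 2) (-((d : ℝ) - a) / 2 - 1)).const_mul (2 * (-((d : ℝ) - a) / 2))
  have h2 := (h (-a / 2 - 1) (-((d : ℝ) - a) / 2)).const_mul (2 * (-a / 2))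
  exact (h1.smul (by fun_prop)).prodMk (((h2.add h1).mul (by fun_prop)).prodMk
    ((h2.add h1).mul (by fun_prop)))

/-- The gradient of `poissonExt a v` off the thin set. -/
def gradExt (a : ℝ) (v : EuclideanSpace ℝ (Fin d) → ℝ) (X : Space d) : Space d :=
  (profileMass d a)⁻¹ • ∫ z, v z • gradKernel a z X

theorem norm_dotCLM_le (P : Space d) : ‖dotCLM P‖ ≤ 3 * ‖P‖ := by
  refine ContinuousLinearMap.opNorm_le_bound _ (by positivity) fun e => ?_
  rw [dotCLM_apply, dot_comm, Real.norm_eq_abs, mul_assoc]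
  exact abs_dot_le _ _

theorem continuous_dotCLM : Continuous (dotCLM (d := d)) := by
  unfold dotCLM
  fun_prop

theorem exists_closedBall_subset_compl_thinSet {X : Space d} (hX : 0 < radSq X) :
    ∃ r > 0, Metric.closedBall X r ⊆ (thinSet d)ᶜ :=
  Metric.nhds_basis_closedBall.mem_iff.1
    ((isClosed_thinSet d).isOpen_compl.mem_nhds (mem_compl_thinSet_iff.2 hX))

theorem aestronglyMeasurable_smul_gradKernel {v : EuclideanSpace ℝ (Fin d) → ℝ}
    (hv : Continuous v) (X : Space d) :
    AEStronglyMeasurable (fun z => v z • gradKernel a z X) volume :=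
  hv.aestronglyMeasurable.smul
    (measurable_gradKernel.comp (measurable_const.prodMk measurable_id)).aestronglyMeasurable

theorem aestronglyMeasurable_poissonKernel_mul {v : EuclideanSpace ℝ (Fin d) → ℝ}
    (hv : Continuous v) (X : Space d) :
    AEStronglyMeasurable (fun z => poissonKernel a z X * v z) volume :=
  (measurable_poissonKernel.comp
    (measurable_const.prodMk measurable_id)).aestronglyMeasurable.mul hv.aestronglyMeasurable

section

variable {v : EuclideanSpace ℝ (Fin d) → ℝ} {B : ℝ}

theorem integrable_smul_gradKernel (ha : a < 0) (hv : Continuous v) (hB : ∀ z, |v z| ≤ B)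
    {X : Space d} (hX : 0 < radSq X) : Integrable fun z => v z • gradKernel a z X := by
  obtain ⟨C, hC, h⟩ := exists_kernel_le ha (isCompact_singleton (x := X))
    (singleton_subset_iff.2 (mem_compl_thinSet_iff.2 hX))
  refine (((integrable_profile ha).const_mul C).const_mul B).mono'
    (aestronglyMeasurable_smul_gradKernel hv X) (Eventually.of_forall fun z => ?_)
  rw [norm_smul]
  exact mul_le_mul (hB z) (h X rfl z).2 (norm_nonneg _) ((abs_nonneg _).trans (hB z))

theorem integrable_poissonKernel_mul (ha : a < 0) (hv : Continuous v) (hB : ∀ z, |v z| ≤ B)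
    {X : Space d} (hX : 0 < radSq X) : Integrable fun z => poissonKernel a z X * v z := by
  obtain ⟨C, hC, h⟩ := exists_kernel_le ha (isCompact_singleton (x := X))
    (singleton_subset_iff.2 (mem_compl_thinSet_iff.2 hX))
  refine (((integrable_profile ha).const_mul C).mul_const B).mono'
    (aestronglyMeasurable_poissonKernel_mul hv X) (Eventually.of_forall fun z => ?_)
  rw [norm_mul, Real.norm_of_nonneg (poissonKernel_nonneg z X)]
  exact mul_le_mul (h X rfl z).1 (hB z) (abs_nonneg _)
    (mul_nonneg hC (profile_pos a z).le)

theorem integrable_poissonKernel (ha : a < 0) {X : Space d} (hX : 0 < radSq X) :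
    Integrable fun z => poissonKernel a z X := by
  simpa using integrable_poissonKernel_mul (v := fun _ => 1) (B := 1) ha continuous_const
    (by simp) hX

/-- v is only continuous, so the derivative has to fall on the kernel; hence the unscaled form of
Poisson's formula, differentiated under the integral with the bounds of `exists_kernel_le`. -/
theorem hasFDerivAt_poissonExt (ha : a < 0) (hv : Continuous v) (hB : ∀ z, |v z| ≤ B)
    {X : Space d} (hX : 0 < radSq X) :
    HasFDerivAt (poissonExt a v) (dotCLM (gradExt a v X)) X := by
  obtain ⟨r, hr, hsub⟩ := exists_closedBall_subset_compl_thinSet hX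
  obtain ⟨C, hC, h⟩ := exists_kernel_le ha (isCompact_closedBall X r) hsub
  have hB0 : 0 ≤ B := (abs_nonneg _).trans (hB 0)
  have hnhds := Metric.closedBall_mem_nhds X hr
  have key : HasFDerivAt (fun Y => ∫ z, poissonKernel a z Y * v z)
      (∫ z, v z • dotCLM (gradKernel a z X)) X := by
    refine hasFDerivAt_integral_of_dominated_of_fderiv_le
      (F' := fun Y z => v z • dotCLM (gradKernel a z Y))
      (bound := fun z => B * (3 * (C * profile a z))) hnhds
      (Eventually.of_forall fun Y => aestronglyMeasurable_poissonKernel_mul hv Y)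
      (integrable_poissonKernel_mul ha hv hB hX) ?_
      (Eventually.of_forall fun z Y hY => ?_)
      ((((integrable_profile ha).const_mul C).const_mul 3).const_mul B)
      (Eventually.of_forall fun z Y hY => ?_)
    · exact hv.aestronglyMeasurable.smul (continuous_dotCLM.comp_aestronglyMeasurable
        (measurable_gradKernel.comp
          (measurable_const.prodMk measurable_id)).aestronglyMeasurable)
    · rw [norm_smul]
      refine mul_le_mul (hB z) ((norm_dotCLM_le _).trans ?_) (norm_nonneg _) hB0
      exact mul_le_mul_of_nonneg_left (h Y hY z).2 (by norm_num)
    · exact (hasFDerivAt_radDist _ _ z (mem_compl_thinSet_iff.1 (hsub hY))).mul_const (v z)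
  have hlin : (profileMass d a)⁻¹ • ∫ z, v z • dotCLM (gradKernel a z X)
      = dotCLM (gradExt a v X) := by
    rw [gradExt, dotCLM_smul]
    congr 1
    refine ContinuousLinearMap.ext fun e => ?_
    have hi : Integrable fun z => v z • dotCLM (gradKernel a z X) := by
      refine ((((integrable_profile ha).const_mul C).const_mul 3).const_mul B).mono'
        (hv.aestronglyMeasurable.smul (continuous_dotCLM.comp_aestronglyMeasurable
          (measurable_gradKernel.comp
            (measurable_const.prodMk measurable_id)).aestronglyMeasurable))
        (Eventually.of_forall fun z => ?_)
      rw [norm_smul]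
      refine mul_le_mul (hB z) ((norm_dotCLM_le _).trans ?_) (norm_nonneg _) hB0
      exact mul_le_mul_of_nonneg_left (h X (Metric.mem_closedBall_self hr.le) z).2 (by norm_num)
    rw [ContinuousLinearMap.integral_apply hi, dotCLM_apply, dot_comm, ← dotCLM_apply,
      ← ContinuousLinearMap.integral_comp_comm _ (integrable_smul_gradKernel ha hv hB hX)]
    refine integral_congr_ae (Eventually.of_forall fun z => ?_)
    simp only [smul_apply, map_smul, dotCLM_apply]
    rw [dot_comm]
  rw [← hlin]
  refine (key.const_mul _).congr_of_eventuallyEq ?_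
  filter_upwards [hnhds] with Y hY
  exact poissonExt_eq v (mem_compl_thinSet_iff.1 (hsub hY))

theorem continuousOn_dot {f g : Space d → Space d} {s : Set (Space d)} (hf : ContinuousOn f s)
    (hg : ContinuousOn g s) : ContinuousOn (fun X => dot (f X) (g X)) s := by
  unfold dot
  fun_prop

theorem continuousOn_gradExt (ha : a < 0) (hv : Continuous v) (hB : ∀ z, |v z| ≤ B) :
    ContinuousOn (gradExt a v) (thinSet d)ᶜ := by
  intro X hX
  obtain ⟨r, hr, hsub⟩ := exists_closedBall_subset_compl_thinSet (mem_compl_thinSet_iff.1 hX)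
  obtain ⟨C, hC, h⟩ := exists_kernel_le ha (isCompact_closedBall X r) hsub
  suffices key : ContinuousAt (fun Y => ∫ z, v z • gradKernel a z Y) X from
    (key.const_smul (profileMass d a)⁻¹).continuousWithinAt
  refine continuousAt_of_dominated (bound := fun z => B * (C * profile a z))
    (Eventually.of_forall fun Y => aestronglyMeasurable_smul_gradKernel hv Y) ?_
    (((integrable_profile ha).const_mul C).const_mul B) (Eventually.of_forall fun z => ?_)
  · filter_upwards [Metric.closedBall_mem_nhds X hr] with Y hY
    refine Eventually.of_forall fun z => ?_
    rw [norm_smul]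
    exact mul_le_mul (hB z) (h Y hY z).2 (norm_nonneg _) ((abs_nonneg _).trans (hB z))
  · have hk : ContinuousAt (gradKernel a z) X := (continuousOn_gradRadDist _ _ z).continuousAt
      ((isClosed_thinSet d).isOpen_compl.mem_nhds hX)
    exact hk.const_smul (v z)

/-- By Fubini the integral over X can be taken first, and it vanishes for every pole z. -/
theorem integral_weight_mul_fderiv_gradExt (ha : a ∈ Ioo (-1 : ℝ) 0) (hv : Continuous v)
    (hB : ∀ z, |v z| ≤ B) {φ : Space d → ℝ} (hφ : IsTest (thinSet d)ᶜ φ) :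
    ∫ X : Space d, |X.2.2| ^ a * fderiv ℝ φ X (gradExt a v X) = 0 := by
  obtain ⟨C, hC, h⟩ := exists_kernel_le ha.2 hφ.2.1 hφ.2.2
  have hB0 : 0 ≤ B := (abs_nonneg _).trans (hB 0)
  have hfd : Continuous (fderiv ℝ φ) := hφ.1.continuous_fderiv (by simp)
  have hz : ∀ X, X ∉ tsupport φ → fderiv ℝ φ X = 0 := fun X hX => by
    by_contra hne
    exact hX (support_fderiv_subset ℝ hne)
  set F : Space d → EuclideanSpace ℝ (Fin d) → ℝ := fun X z =>
    |X.2.2| ^ a * (v z * fderiv ℝ φ X (gradKernel a z X)) with hF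
  have h1 : ∀ X : Space d, |X.2.2| ^ a * fderiv ℝ φ X (gradExt a v X)
      = (profileMass d a)⁻¹ * ∫ z, F X z := by
    intro X
    simp only [hF]
    by_cases hX : X ∈ tsupport φ
    · have hi := integrable_smul_gradKernel (a := a) ha.2 hv hB
        (mem_compl_thinSet_iff.1 (hφ.2.2 hX))
      rw [gradExt, map_smul, ← ContinuousLinearMap.integral_comp_comm _ hi, integral_const_mul]
      simp only [map_smul, smul_eq_mul]
      ring
    · simp [hz X hX]
  have hwd : Integrable fun X : Space d => |X.2.2| ^ a * ‖fderiv ℝ φ X‖ := by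
    refine (integrableOn_iff_integrable_of_support_subset (s := tsupport φ) fun X hX => ?_).1
      (((locallyIntegrable_weight ha).integrableOn_isCompact hφ.2.1).mul_continuousOn
        hfd.norm.continuousOn hφ.2.1)
    by_contra hne
    exact hX (by simp [hz X hne])
  have hFi : Integrable (Function.uncurry F) (volume.prod volume) := by
    refine ((hwd.mul_prod ((integrable_profile ha.2).const_mul C)).const_mul B).mono' ?_
      (Eventually.of_forall fun p => ?_)
    · have m1 : AEStronglyMeasurable (fun p : Space d × EuclideanSpace ℝ (Fin d) =>
          fderiv ℝ φ p.1 (gradKernel a p.2 p.1)) (volume.prod volume) :=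
        isBoundedBilinearMap_apply.continuous.comp_aestronglyMeasurable
          ((hfd.comp continuous_fst).aestronglyMeasurable.prodMk
            measurable_gradKernel.aestronglyMeasurable)
      exact (measurable_weight.comp measurable_fst).aestronglyMeasurable.mul
        ((hv.comp continuous_snd).aestronglyMeasurable.mul m1)
    · obtain ⟨X, z⟩ := p
      simp only [Function.uncurry_apply_pair, hF]
      rw [norm_mul, norm_mul, Real.norm_of_nonneg (Real.rpow_nonneg (abs_nonneg X.2.2) a)]
      by_cases hX : X ∈ tsupport φ
      · have h2 : ‖fderiv ℝ φ X (gradKernel a z X)‖ ≤ ‖fderiv ℝ φ X‖ * (C * profile a z) :=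
          ((fderiv ℝ φ X).le_opNorm _).trans (by gcongr; exact (h X hX z).2)
        have h3 := mul_le_mul (hB z) h2 (norm_nonneg _) hB0
        calc |X.2.2| ^ a * (‖v z‖ * ‖fderiv ℝ φ X (gradKernel a z X)‖)
            ≤ |X.2.2| ^ a * (B * (‖fderiv ℝ φ X‖ * (C * profile a z))) :=
              mul_le_mul_of_nonneg_left h3 (by positivity)
          _ = _ := by ring
      · simp [hz X hX]
  simp only [h1]
  rw [integral_const_mul, integral_integral_swap hFi]
  have h2 : ∀ z, ∫ X, F X z = 0 := by
    intro z
    have h3 : ∀ X : Space d, F X z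
        = v z * (|X.2.2| ^ a * fderiv ℝ φ X (gradKernel a z X)) := fun X => by
      simp only [hF]; ring
    simp only [h3]
    rw [integral_const_mul, integral_weight_mul_fderiv_gradKernel ha z hφ, mul_zero]
  simp [h2]

theorem isAHarmonicOn_poissonExt (ha : a ∈ Ioo (-1 : ℝ) 0) (hv : Continuous v)
    (hB : ∀ z, |v z| ≤ B) : IsAHarmonicOn a (thinSet d)ᶜ (poissonExt a v) := by
  have hc := continuous_poissonExt ha.2 hv hB
  have hg := continuousOn_gradExt ha.2 hv hB
  have hm : MeasurableSet (thinSet d)ᶜ := (isClosed_thinSet d).isOpen_compl.measurableSet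
  have hl : IsLocallyClosed (thinSet d)ᶜ := (isClosed_thinSet d).isOpen_compl.isLocallyClosed
  have hw := (locallyIntegrable_weight (d := d) ha).locallyIntegrableOn (thinSet d)ᶜ
  have h1 : IsWeakGradient (thinSet d)ᶜ (poissonExt a v) (gradExt a v) := by
    refine ⟨hc.locallyIntegrable.locallyIntegrableOn _, hg.locallyIntegrableOn hm,
      fun φ hφ e => ?_⟩
    have hd : ∀ X ∈ (thinSet d)ᶜ,
        HasLineDerivAt ℝ (poissonExt a v) (dot (gradExt a v X) e) X e := fun X hX => by
      have h1 :=
        (hasFDerivAt_poissonExt ha.2 hv hB (mem_compl_thinSet_iff.1 hX)).hasLineDerivAt e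
      rwa [dotCLM_apply, dot_comm] at h1
    exact hφ.integral_mul_fderiv (f' := fun X => dot (gradExt a v X) e) hc.continuousOn
      (continuousOn_dot hg continuousOn_const) hd
  have h2 : LocallyIntegrableOn (fun X : Space d => |X.2.2| ^ a * poissonExt a v X ^ 2)
      (thinSet d)ᶜ :=
    hw.mul_continuousOn (g := fun X => poissonExt a v X ^ 2) (hc.pow 2).continuousOn hl
  have h3 : LocallyIntegrableOn
      (fun X : Space d => |X.2.2| ^ a * dot (gradExt a v X) (gradExt a v X)) (thinSet d)ᶜ :=
    hw.mul_continuousOn (g := fun X => dot (gradExt a v X) (gradExt a v X)) (continuousOn_dot hg hg) hl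
  exact ⟨gradExt a v, h1, h2, h3, fun φ hφ => integral_weight_mul_fderiv_gradExt ha hv hB hφ⟩

/-- The data are split at a ball S outside which |v| ≤ ε/4. The outer part contributes at most ε/4
since the kernel has constant mass; on S the kernel is at most T^(-d). For d = 0 the kernel is
constant off the thin set, so d ≥ 1 is essential. -/
theorem tendsto_poissonExt_cocompact (hd : 1 ≤ d) (ha : a < 0) (hv : Continuous v)
    (h0 : Tendsto v (cocompact (EuclideanSpace ℝ (Fin d))) (𝓝 0)) :
    Tendsto (poissonExt a v) (cocompact (Space d)) (𝓝 0) := by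
  obtain ⟨B, hB0, hB⟩ := exists_abs_le_of_tendsto_cocompact hv h0
  have hM := profileMass_pos (d := d) ha
  rw [Metric.tendsto_nhds]
  intro ε hε
  obtain ⟨R, hR0, hR⟩ : ∃ R : ℝ, 0 ≤ R ∧ ∀ z, R < ‖z‖ → |v z| ≤ ε / 4 := by
    obtain ⟨t, ht, hsub⟩ := mem_cocompact.1
      (h0.eventually (Metric.ball_mem_nhds 0 (show 0 < ε / 4 by positivity)))
    obtain ⟨R, hR⟩ := ht.isBounded.exists_norm_le
    refine ⟨max R 0, le_max_right _ _, fun z hz => ?_⟩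
    have hzt : z ∉ t := fun hzt => not_lt.2 ((hR z hzt).trans (le_max_left _ _)) hz
    have h1 : v z ∈ Metric.ball 0 (ε / 4) := hsub hzt
    rw [Metric.mem_ball, dist_zero_right, Real.norm_eq_abs] at h1
    exact h1.le
  set S := Metric.closedBall (0 : EuclideanSpace ℝ (Fin d)) R
  set L := (profileMass d a)⁻¹ * (B * volume.real S)
  obtain ⟨T, hT0, hT⟩ : ∃ T : ℝ, 0 < T ∧ T ^ (-(d : ℝ)) * L < ε / 4 := by
    have hlim : Tendsto (fun T : ℝ => T ^ (-(d : ℝ)) * L) atTop (𝓝 (0 * L)) :=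
      (tendsto_rpow_neg_atTop (by exact_mod_cast hd)).mul_const L
    rw [zero_mul] at hlim
    obtain ⟨T, h1, h2⟩ := ((hlim.eventually (gt_mem_nhds (show 0 < ε / 4 by positivity))).and
      (eventually_gt_atTop 0)).exists
    exact ⟨T, h2, h1⟩
  -- In the maximum norm, a point this far out either has |x'| large, so that |x' - z| ≥ T for z in
  -- S, or has |x_n| or |y| at least T. For points of the thin set it gives |x'| > R.
  have hlarge : ∀ᶠ X : Space d in cocompact (Space d), T + R + T < ‖X‖ :=
    (tendsto_norm_cocompact_atTop (E := Space d)).eventually (eventually_gt_atTop _)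
  filter_upwards [hlarge] with X hX
  rw [dist_zero_right, Real.norm_eq_abs]
  rcases (radSq_nonneg X).eq_or_lt with hρ | hρ
  · rw [poissonExt_of_radSq_eq_zero ha v hρ.symm]
    have h1 : X.2.1 = 0 ∧ X.2.2 = 0 := by
      by_contra hne
      exact hρ.not_lt (mem_compl_thinSet_iff.1 hne)
    have h2 : ‖X‖ = ‖X.1‖ := by
      simp [Prod.norm_def, h1.1, h1.2]
    have := hR X.1 (by linarith)
    linarith
  · have hker : ∀ z ∈ S, poissonKernel a z X ≤ T ^ (-(d : ℝ)) := by
      intro z hz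
      have hz' : ‖z‖ ≤ R := mem_closedBall_zero_iff.1 hz
      have hq0 : 0 < distSq z X := hρ.trans_le (radSq_le_distSq z X)
      have hTq : T ^ 2 ≤ distSq z X := by
        by_cases h1 : ‖X‖ = ‖X.1‖
        · have h2 : T ≤ ‖X.1 - z‖ := by
            have := norm_sub_norm_le X.1 z
            linarith
          have h3 : T ^ 2 ≤ ‖X.1 - z‖ ^ 2 := by gcongr
          unfold distSq
          linarith
        · have h2 : ‖X‖ = ‖X.2‖ := (max_choice ‖X.1‖ ‖X.2‖).resolve_left h1
          refine le_trans ?_ (radSq_le_distSq z X)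
          unfold radSq
          rcases max_choice ‖X.2.1‖ ‖X.2.2‖ with h3 | h3
          · have h4 : T ≤ |X.2.1| := by
              have : ‖X.2‖ = |X.2.1| := h3
              linarith
            have : T ^ 2 ≤ |X.2.1| ^ 2 := by gcongr
            rw [sq_abs] at this
            linarith [sq_nonneg X.2.2]
          · have h4 : T ≤ |X.2.2| := by
              have : ‖X.2‖ = |X.2.2| := h3
              linarith
            have : T ^ 2 ≤ |X.2.2| ^ 2 := by gcongr
            rw [sq_abs] at this
            linarith [sq_nonneg X.2.1]
      calc poissonKernel a z X
          ≤ distSq z X ^ (-a / 2) * distSq z X ^ (-((d : ℝ) - a) / 2) := by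
            unfold poissonKernel radDist
            gcongr
            · linarith
            · exact radSq_le_distSq z X
        _ = distSq z X ^ (-(d : ℝ) / 2) := by
            rw [← Real.rpow_add hq0]
            congr 1
            ring
        _ ≤ (T ^ 2) ^ (-(d : ℝ) / 2) :=
            Real.rpow_le_rpow_of_nonpos (by positivity) hTq
              (by have : (0 : ℝ) ≤ d := Nat.cast_nonneg d
                  linarith)
        _ = T ^ (-(d : ℝ)) := by
            rw [← Real.rpow_natCast, ← Real.rpow_mul hT0.le]
            congr 1
            push_cast
            ring
    have hki := integrable_poissonKernel ha hρ
    have hSi : Integrable (S.indicator fun _ => T ^ (-(d : ℝ)) * B) :=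
      (integrableOn_const (isCompact_closedBall _ _).measure_lt_top.ne).integrable_indicator
        measurableSet_closedBall
    have hpt : ∀ z, |poissonKernel a z X * v z|
        ≤ S.indicator (fun _ => T ^ (-(d : ℝ)) * B) z + poissonKernel a z X * (ε / 4) := by
      intro z
      have hk0 := poissonKernel_nonneg (a := a) z X
      rw [abs_mul, abs_of_nonneg hk0]
      by_cases hz : z ∈ S
      · rw [indicator_of_mem hz]
        have h1 := mul_le_mul (hker z hz) (hB z) (abs_nonneg _) (by positivity)
        have h2 : 0 ≤ poissonKernel a z X * (ε / 4) := by positivity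
        linarith
      · rw [indicator_of_notMem hz, zero_add]
        refine mul_le_mul_of_nonneg_left (hR z ?_) hk0
        exact not_le.1 fun h => hz (mem_closedBall_zero_iff.2 h)
    have hint : |∫ z, poissonKernel a z X * v z|
        ≤ T ^ (-(d : ℝ)) * B * volume.real S + profileMass d a * (ε / 4) := by
      calc _ ≤ ∫ z, (S.indicator (fun _ => T ^ (-(d : ℝ)) * B) z + poissonKernel a z X * (ε / 4)) :=
            (abs_integral_le_integral_abs).trans (integral_mono
              (integrable_poissonKernel_mul ha hv hB hρ).abs (hSi.add (hki.mul_const _)) hpt)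
        _ = _ := by
            rw [integral_add hSi (hki.mul_const _), integral_indicator measurableSet_closedBall,
              setIntegral_const, integral_mul_const, integral_poissonKernel hρ, smul_eq_mul]
            ring
    rw [poissonExt_eq v hρ, abs_mul, abs_of_pos (inv_pos.2 hM)]
    calc _ ≤ (profileMass d a)⁻¹
          * (T ^ (-(d : ℝ)) * B * volume.real S + profileMass d a * (ε / 4)) := by gcongr
      _ = T ^ (-(d : ℝ)) * L + ε / 4 := by
          simp only [L]
          field_simp
      _ < ε := by linarith

theorem isAHarmonicExtension_poissonExt (hd : 1 ≤ d) (ha : a ∈ Ioo (-1 : ℝ) 0)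
    (hv : Continuous v) (h0 : Tendsto v (cocompact (EuclideanSpace ℝ (Fin d))) (𝓝 0)) :
    IsAHarmonicExtension a v (poissonExt a v) := by
  obtain ⟨B, -, hB⟩ := exists_abs_le_of_tendsto_cocompact hv h0
  exact ⟨continuous_poissonExt ha.2 hv hB, isAHarmonicOn_poissonExt ha hv hB,
    fun x => poissonExt_of_radSq_eq_zero ha.2 v (by simp [radSq]),
    tendsto_poissonExt_cocompact hd ha.2 hv h0⟩

end

/-! ### The flux through small circles -/

/-- Jordan's inequality sin θ ≥ 2θ/π reduces the singularity at 0 to θ^a with a > -1; reflection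
handles the one at π. -/
theorem intervalIntegrable_abs_sin_rpow_zero_pi (ha : a ∈ Ioo (-1 : ℝ) 0) :
    IntervalIntegrable (fun θ => |Real.sin θ| ^ a) volume 0 Real.pi := by
  have hπ := Real.pi_pos
  have hm : Measurable fun θ : ℝ => |Real.sin θ| ^ a := by fun_prop
  have h1 : IntervalIntegrable (fun θ => |Real.sin θ| ^ a) volume 0 (Real.pi / 2) := by
    have hdom : IntervalIntegrable (fun θ : ℝ => (2 / Real.pi) ^ a * θ ^ a) volume 0
        (Real.pi / 2) := (intervalIntegral.intervalIntegrable_rpow' ha.1).const_mul _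
    refine hdom.mono_fun hm.aestronglyMeasurable ?_
    refine (ae_restrict_iff' measurableSet_uIoc).2 (Eventually.of_forall fun θ hθ => ?_)
    rw [uIoc_of_le (by positivity)] at hθ
    have h2 := Real.mul_le_sin hθ.1.le hθ.2
    have h3 : 0 < 2 / Real.pi * θ := mul_pos (by positivity) hθ.1
    have hθ0 : 0 < θ := hθ.1
    simp only
    rw [Real.norm_of_nonneg (by positivity), Real.norm_of_nonneg (by positivity),
      ← Real.mul_rpow (by positivity) hθ0.le, abs_of_pos (h3.trans_le h2)]
    exact Real.rpow_le_rpow_of_nonpos h3 h2 ha.2.le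
  have h2 := h1.comp_sub_left Real.pi
  simp only [Real.sin_pi_sub, sub_zero, sub_half] at h2
  exact h1.trans h2.symm

theorem intervalIntegrable_abs_sin_rpow (ha : a ∈ Ioo (-1 : ℝ) 0) :
    IntervalIntegrable (fun θ => |Real.sin θ| ^ a) volume 0 (2 * Real.pi) := by
  have h1 := intervalIntegrable_abs_sin_rpow_zero_pi ha
  have h2 := h1.comp_sub_right Real.pi
  simp only [Real.sin_sub_pi, abs_neg, zero_add] at h2
  rw [two_mul]
  exact h1.trans h2

theorem integral_abs_sin_rpow_pos (ha : a ∈ Ioo (-1 : ℝ) 0) :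
    0 < ∫ θ in (0 : ℝ)..(2 * Real.pi), |Real.sin θ| ^ a := by
  have hπ := Real.pi_pos
  have h1 := intervalIntegrable_abs_sin_rpow_zero_pi ha
  have h2 : IntervalIntegrable (fun θ => |Real.sin θ| ^ a) volume Real.pi (2 * Real.pi) :=
    h1.symm.trans (intervalIntegrable_abs_sin_rpow ha)
  rw [← intervalIntegral.integral_add_adjacent_intervals h1 h2]
  refine add_pos_of_pos_of_nonneg (intervalIntegral.intervalIntegral_pos_of_pos_on h1
    (fun θ hθ => ?_) hπ) (intervalIntegral.integral_nonneg (by linarith) fun θ _ => by positivity)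
  have := Real.sin_pos_of_pos_of_lt_pi hθ.1 hθ.2
  positivity

/-- The kernel of the rescaled radial derivative of the Poisson extension at distance `ε`. -/
def fluxKernel (a : ℝ) (x : EuclideanSpace ℝ (Fin d)) (ε : ℝ)
    (z : EuclideanSpace ℝ (Fin d)) : ℝ :=
  -a * (‖x - z‖ ^ 2 + ε ^ 2) ^ (-((d : ℝ) - a) / 2)
    - ((d : ℝ) - a) * (ε ^ 2 * (‖x - z‖ ^ 2 + ε ^ 2) ^ (-((d : ℝ) - a) / 2 - 1))

theorem radSq_circlePoint (x : EuclideanSpace ℝ (Fin d)) (ε θ : ℝ) :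
    radSq (circlePoint x ε θ) = ε ^ 2 := by
  simp only [radSq, circlePoint]
  linear_combination ε ^ 2 * Real.sin_sq_add_cos_sq θ

/-- The factor ε^a of the weight cancels the prefactor r^{-a} of the kernel. What is left has a
finite limit as ε → 0 for z ≠ x and does not depend on θ. -/
theorem normCoeff_circlePoint (x z : EuclideanSpace ℝ (Fin d)) {ε : ℝ} (hε : 0 < ε) (θ : ℝ) :
    ε ^ a * ε * (normCoeff a z (circlePoint x ε θ) * ε) = fluxKernel a x ε z := by
  have hq : distSq z (circlePoint x ε θ) = ‖x - z‖ ^ 2 + ε ^ 2 := by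
    rw [distSq, radSq_circlePoint, circlePoint]
  have h1 : (ε ^ 2) ^ (-a / 2) = (ε ^ a)⁻¹ := by
    rw [← Real.rpow_natCast, ← Real.rpow_mul hε.le, ← Real.rpow_neg hε.le]
    congr 1
    push_cast
    ring
  have h2 : ε ^ a ≠ 0 := (Real.rpow_pos_of_pos hε a).ne'
  simp only [normCoeff, tangCoeff, radDist, hq, radSq_circlePoint, fluxKernel]
  rw [Real.rpow_sub_one (by positivity : ε ^ 2 ≠ 0) (-a / 2), h1]
  field_simp
  ring

section

variable {v : EuclideanSpace ℝ (Fin d) → ℝ} {B : ℝ}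

theorem dot_gradExt_circlePoint (ha : a < 0) (hv : Continuous v) (hB : ∀ z, |v z| ≤ B)
    (x : EuclideanSpace ℝ (Fin d)) {ε : ℝ} (hε : 0 < ε) (θ : ℝ) :
    Integrable (fun z => v z * fluxKernel a x ε z) ∧
    ε ^ a * ε * dot (gradExt a v (circlePoint x ε θ)) (0, Real.cos θ, Real.sin θ)
      = (profileMass d a)⁻¹ * ∫ z, v z * fluxKernel a x ε z := by
  have hX : 0 < radSq (circlePoint x ε θ) := by rw [radSq_circlePoint]; positivity
  have hi := integrable_smul_gradKernel ha hv hB hX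
  have h1 : ∀ z, ε ^ a * ε * dotCLM (0, Real.cos θ, Real.sin θ)
      (v z • gradKernel a z (circlePoint x ε θ)) = v z * fluxKernel a x ε z := by
    intro z
    rw [map_smul, dotCLM_apply, ← normCoeff_circlePoint x z hε θ, gradKernel_eq]
    simp only [dot, circlePoint, inner_zero_right, smul_eq_mul]
    linear_combination ε ^ a * ε * v z * normCoeff a z (x, ε * Real.cos θ, ε * Real.sin θ) * ε
      * Real.sin_sq_add_cos_sq θ
  refine ⟨?_, ?_⟩
  · have h2 := ((dotCLM (0, Real.cos θ, Real.sin θ)).integrable_comp hi).const_mul (ε ^ a * ε)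
    simpa only [h1] using h2
  · rw [← dotCLM_apply, gradExt, map_smul, ← ContinuousLinearMap.integral_comp_comm _ hi]
    simp only [← h1]
    rw [integral_const_mul, smul_eq_mul]
    ring

/-- The Poisson kernel reproduces constants, so its radial derivative has mean zero. -/
theorem integral_fluxKernel (ha : a < 0) (x : EuclideanSpace ℝ (Fin d)) {ε : ℝ} (hε : 0 < ε) :
    Integrable (fluxKernel a x ε) ∧ ∫ z, fluxKernel a x ε z = 0 := by
  have hM := profileMass_pos (d := d) ha
  have hc : ∀ z : EuclideanSpace ℝ (Fin d), |(fun _ => (1 : ℝ)) z| ≤ 1 := by simp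
  -- The constant 1 does not vanish at infinity; the differentiation lemmas ask only for bounded
  -- continuous data so that they apply here.
  have h1 : poissonExt a (fun _ : EuclideanSpace ℝ (Fin d) => (1 : ℝ)) = fun _ => 1 := by
    ext1 X
    simp only [poissonExt, mul_one]
    exact inv_mul_cancel₀ hM.ne'
  have hX : 0 < radSq (circlePoint x ε 0) := by rw [radSq_circlePoint]; positivity
  have h2 := hasFDerivAt_poissonExt ha continuous_const hc hX
  rw [h1] at h2
  have h3 := h2.unique (hasFDerivAt_const (1 : ℝ) _)
  have h4 : dot (gradExt a (fun _ => (1 : ℝ)) (circlePoint x ε 0)) (0, Real.cos 0, Real.sin 0)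
      = 0 := by
    rw [dot_comm, ← dotCLM_apply, h3]
    rfl
  obtain ⟨h5, h6⟩ := dot_gradExt_circlePoint ha continuous_const hc x hε 0
  simp only [one_mul] at h5 h6
  rw [h4, mul_zero] at h6
  exact ⟨h5, (mul_eq_zero.1 h6.symm).resolve_left (inv_pos.2 hM).ne'⟩

/-- The mean-zero property inserts v(x), which tames the singularity of the limiting kernel. By
rotational symmetry in (x_n, y) the angle survives only in the weight, so the flux factors exactly
for each ε. -/
theorem fluxIntegrand_poissonExt (ha : a < 0) (hv : Continuous v) (hB : ∀ z, |v z| ≤ B)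
    (x : EuclideanSpace ℝ (Fin d)) {ε : ℝ} (hε : 0 < ε) (θ : ℝ) :
    fluxIntegrand a (poissonExt a v) x ε θ
      = -((profileMass d a)⁻¹ * ∫ z, (v x - v z) * fluxKernel a x ε z) * |Real.sin θ| ^ a := by
  have hX : 0 < radSq (circlePoint x ε θ) := by rw [radSq_circlePoint]; positivity
  obtain ⟨h1, h2⟩ := dot_gradExt_circlePoint ha hv hB x hε θ
  obtain ⟨h3, h4⟩ := integral_fluxKernel (a := a) ha x hε
  have h5 : ∫ z, (v x - v z) * fluxKernel a x ε z = - ∫ z, v z * fluxKernel a x ε z := by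
    simp only [sub_mul]
    rw [integral_sub (h3.const_mul _) h1, integral_const_mul, h4, mul_zero, zero_sub]
  rw [h5, fluxIntegrand, (hasFDerivAt_poissonExt ha hv hB hX).fderiv, dotCLM_apply, dot_comm,
    abs_mul, abs_of_pos hε, Real.mul_rpow hε.le (abs_nonneg _), mul_neg, neg_neg, ← h2]
  ring

/-- With q = |x - z|² + ε², both q^{-(d-a)/2} and ε² q^{-(d-a)/2-1} are at most |x - z|^{-(d-a)},
and the second tends to zero. Since d - a = d + 2σ for σ = -a/2, absolute convergence of the
singular integral supplies the dominating function. -/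
theorem tendsto_integral_fluxKernel (ha : a < 0) (hv : Continuous v)
    {x : EuclideanSpace ℝ (Fin d)} (hx : Integrable (fracIntegrand (-a / 2) v x)) :
    Tendsto (fun ε => ∫ z, (v x - v z) * fluxKernel a x ε z) (𝓝[>] 0)
      (𝓝 (∫ z, -a * fracIntegrand (-a / 2) v x z)) := by
  have hda : 0 < (d : ℝ) - a := by
    have : (0 : ℝ) ≤ d := Nat.cast_nonneg d
    linarith
  have hpow : ∀ z, (‖x - z‖ ^ 2) ^ (-((d : ℝ) - a) / 2)
      = (‖x - z‖ ^ ((d : ℝ) + 2 * (-a / 2)))⁻¹ := by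
    intro z
    rw [← Real.rpow_natCast, ← Real.rpow_mul (norm_nonneg _), ← Real.rpow_neg (norm_nonneg _)]
    congr 1
    push_cast
    ring
  refine tendsto_integral_filter_of_dominated_convergence
    (fun z => (-a + ((d : ℝ) - a)) * ‖fracIntegrand (-a / 2) v x z‖) ?_ ?_ (hx.norm.const_mul _)
    (Eventually.of_forall fun z => ?_)
  · filter_upwards [self_mem_nhdsWithin] with ε hε
    have hpos : ∀ z, ‖x - z‖ ^ 2 + ε ^ 2 ≠ 0 := fun z => by
      have : 0 < ε := hε
      positivity
    have hc : ∀ p : ℝ, Continuous fun z => (‖x - z‖ ^ 2 + ε ^ 2) ^ p := fun p =>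
      Continuous.rpow_const (by fun_prop) fun z => Or.inl (hpos z)
    have h1 := hc (-((d : ℝ) - a) / 2)
    have h2 := hc (-((d : ℝ) - a) / 2 - 1)
    refine Continuous.aestronglyMeasurable ?_
    unfold fluxKernel
    fun_prop
  · filter_upwards [self_mem_nhdsWithin] with ε hε
    have hε0 : 0 < ε := hε
    refine Eventually.of_forall fun z => ?_
    by_cases hz : z = x
    · simp [hz, fracIntegrand]
    · have hn : 0 < ‖x - z‖ := norm_sub_pos_iff.2 (Ne.symm hz)
      set q := ‖x - z‖ ^ 2 + ε ^ 2 with hq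
      have hq0 : 0 < q := by positivity
      have h1 : q ^ (-((d : ℝ) - a) / 2) ≤ (‖x - z‖ ^ ((d : ℝ) + 2 * (-a / 2)))⁻¹ := by
        rw [← hpow]
        exact Real.rpow_le_rpow_of_nonpos (by positivity) (by rw [hq]; linarith [sq_nonneg ε])
          (by linarith)
      have h2 : ε ^ 2 * q ^ (-((d : ℝ) - a) / 2 - 1) ≤ q ^ (-((d : ℝ) - a) / 2) := by
        rw [Real.rpow_sub_one hq0.ne', mul_div_assoc', div_le_iff₀ hq0, mul_comm]
        gcongr
        rw [hq]
        linarith [sq_nonneg ‖x - z‖]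
      have h3 : |fluxKernel a x ε z|
          ≤ (-a + ((d : ℝ) - a)) * (‖x - z‖ ^ ((d : ℝ) + 2 * (-a / 2)))⁻¹ := by
        rw [fluxKernel, ← hq]
        have n1 : 0 ≤ q ^ (-((d : ℝ) - a) / 2) := by positivity
        have n2 : 0 ≤ ε ^ 2 * q ^ (-((d : ℝ) - a) / 2 - 1) := by positivity
        have m1 := mul_le_mul_of_nonneg_left h1 (neg_nonneg.2 ha.le)
        have m2 := mul_le_mul_of_nonneg_left (h2.trans h1) hda.le
        have m3 := mul_nonneg (neg_nonneg.2 ha.le) n1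
        have m4 := mul_nonneg hda.le n2
        rw [abs_le]
        constructor <;> nlinarith
      rw [norm_mul, fracIntegrand, norm_div, Real.norm_eq_abs (fluxKernel a x ε z),
        Real.norm_of_nonneg (Real.rpow_nonneg hn.le _)]
      calc ‖v x - v z‖ * |fluxKernel a x ε z|
          ≤ ‖v x - v z‖ * ((-a + ((d : ℝ) - a)) * (‖x - z‖ ^ ((d : ℝ) + 2 * (-a / 2)))⁻¹) := by
            gcongr
        _ = _ := by ring
  · by_cases hz : z = x
    · simp [hz, fracIntegrand]
    · have hn : 0 < ‖x - z‖ := norm_sub_pos_iff.2 (Ne.symm hz)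
      have hε : Tendsto (fun ε : ℝ => ε ^ 2) (𝓝[>] 0) (𝓝 0) := by
        have : Tendsto (fun ε : ℝ => ε ^ 2) (𝓝 0) (𝓝 (0 ^ 2)) :=
          (continuous_pow 2).tendsto 0
        rw [zero_pow (by norm_num)] at this
        exact this.mono_left nhdsWithin_le_nhds
      have hq : ∀ p : ℝ, Tendsto (fun ε : ℝ => (‖x - z‖ ^ 2 + ε ^ 2) ^ p) (𝓝[>] 0)
          (𝓝 ((‖x - z‖ ^ 2 + 0) ^ p)) := fun p =>
        (tendsto_const_nhds.add hε).rpow_const (Or.inl (by positivity))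
      have h1 := (((hq (-((d : ℝ) - a) / 2)).const_mul (-a)).sub
        ((hε.mul (hq (-((d : ℝ) - a) / 2 - 1))).const_mul ((d : ℝ) - a))).const_mul (v x - v z)
      have hlim : -a * fracIntegrand (-a / 2) v x z = (v x - v z)
          * (-a * (‖x - z‖ ^ 2 + 0) ^ (-((d : ℝ) - a) / 2)
            - ((d : ℝ) - a) * (0 * (‖x - z‖ ^ 2 + 0) ^ (-((d : ℝ) - a) / 2 - 1))) := by
        rw [add_zero, hpow, fracIntegrand]
        ring
      rw [hlim]
      exact h1

theorem hasFlux_poissonExt (ha : a ∈ Ioo (-1 : ℝ) 0) (hv : Continuous v) (hB : ∀ z, |v z| ≤ B)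
    {x : EuclideanSpace ℝ (Fin d)} (hx : Integrable (fracIntegrand (-a / 2) v x)) :
    HasFlux a (poissonExt a v) x
      (-((∫ θ in (0 : ℝ)..(2 * Real.pi), |Real.sin θ| ^ a) * (profileMass d a)⁻¹ * -a
        * ∫ z, fracIntegrand (-a / 2) v x z)) := by
  have hflux := fun (ε : ℝ) (hε : 0 < ε) (θ : ℝ) =>
    fluxIntegrand_poissonExt ha.2 hv hB x hε θ
  refine ⟨?_, ?_⟩
  · filter_upwards [self_mem_nhdsWithin] with ε hε
    have hε0 : 0 < ε := hε
    refine ⟨fun θ => (hasFDerivAt_poissonExt ha.2 hv hB ?_).differentiableAt, ?_⟩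
    · rw [radSq_circlePoint]
      positivity
    · rw [show fluxIntegrand a (poissonExt a v) x ε = _ from funext (hflux ε hε)]
      exact (intervalIntegrable_abs_sin_rpow ha).const_mul _
  · have h1 := (((tendsto_integral_fluxKernel ha.2 hv hx).const_mul
      (profileMass d a)⁻¹).neg).mul_const (∫ θ in (0 : ℝ)..(2 * Real.pi), |Real.sin θ| ^ a)
    rw [integral_const_mul] at h1
    refine (h1.congr' ?_).trans_eq ?_
    · filter_upwards [self_mem_nhdsWithin] with ε hε
      simp only [hflux ε hε]
      rw [intervalIntegral.integral_const_mul]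
    · congr 1
      ring

end

/-! ### The constant c and the conclusion -/

/-- The normalizing constant of the fractional Laplacian. -/
def fracConst (d : ℕ) (σ : ℝ) : ℝ :=
  4 ^ σ * Real.Gamma ((d : ℝ) / 2 + σ) / (Real.pi ^ ((d : ℝ) / 2) * |Real.Gamma (-σ)|)

/-- For 0 < σ < 1 the point -σ is not a pole of Γ. At the poles `Real.Gamma` is zero by convention,
so this must be excluded for |Γ(-σ)| to be positive. -/
theorem fracConst_pos (d : ℕ) {σ : ℝ} (hσ : σ ∈ Ioo (0 : ℝ) 1) : 0 < fracConst d σ := by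
  obtain ⟨h0, h1⟩ := hσ
  have hΓ : Real.Gamma (-σ) ≠ 0 := by
    refine Real.Gamma_ne_zero fun m hm => ?_
    have hm' : σ = m := by linarith
    rw [hm'] at h0 h1
    have h2 : 0 < m := by exact_mod_cast h0
    have h3 : m < 1 := by exact_mod_cast h1
    omega
  have h2 : 0 < Real.Gamma ((d : ℝ) / 2 + σ) := Real.Gamma_pos_of_pos (by positivity)
  have h3 : 0 < |Real.Gamma (-σ)| := abs_pos.2 hΓ
  unfold fracConst
  positivity

end VeryThin

end

theorem proposition8p2 (n : ℕ) (hn : 2 ≤ n) (a s : ℝ) (ha : a ∈ Set.Ioo (-1 : ℝ) 0)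
    (hs : s = (1 - a) / 2) :
    ∃ c : ℝ, 0 < c ∧
      ∀ v : EuclideanSpace ℝ (Fin (n - 1)) → ℝ, Continuous v →
        Tendsto v (cocompact (EuclideanSpace ℝ (Fin (n - 1)))) (𝓝 0) →
        (∃! V : VeryThin.Space (n - 1) → ℝ, VeryThin.IsAHarmonicExtension a v V) ∧
        ∀ V : VeryThin.Space (n - 1) → ℝ, VeryThin.IsAHarmonicExtension a v V →
          ∀ x' : EuclideanSpace ℝ (Fin (n - 1)),
            Integrable (VeryThin.fracIntegrand (-a / 2) v x') →
            VeryThin.HasFlux a V x' (-(c * VeryThin.fracLaplacian (-a / 2) v x')) ∧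
            VeryThin.fracLaplacian (-a / 2) v x' = VeryThin.fracLaplacian (s - 1 / 2) v x' := by
  have hd : 1 ≤ n - 1 := by omega
  have hσ : -a / 2 ∈ Set.Ioo (0 : ℝ) 1 := ⟨by linarith [ha.2], by linarith [ha.1]⟩
  have hC := VeryThin.fracConst_pos (n - 1) hσ
  have hS := VeryThin.integral_abs_sin_rpow_pos ha
  have hM := VeryThin.profileMass_pos (d := n - 1) ha.2
  have hna : 0 < -a := by linarith [ha.2]
  -- The flux is -S (-a) / M times the bare singular integral, with S = ∫ |sin θ|^a dθ and M the
  -- mass of the profile; dividing by the normalizing constant of the fractional Laplacian gives c.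
  refine ⟨(∫ θ in (0 : ℝ)..(2 * Real.pi), |Real.sin θ| ^ a) * (VeryThin.profileMass (n - 1) a)⁻¹
    * -a / VeryThin.fracConst (n - 1) (-a / 2), by positivity, fun v hv h0 => ?_⟩
  obtain ⟨B, -, hB⟩ := VeryThin.exists_abs_le_of_tendsto_cocompact hv h0
  have hext := VeryThin.isAHarmonicExtension_poissonExt hd ha hv h0
  refine ⟨⟨_, hext, fun V hV => hV.unique ha hext⟩, fun V hV x' hx' => ⟨?_, ?_⟩⟩
  -- Uniqueness replaces an arbitrary extension by Poisson's formula, for which the flux is known.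
  · rw [hV.unique ha hext]
    have h1 := VeryThin.hasFlux_poissonExt ha hv hB hx'
    convert h1 using 2
    rw [VeryThin.fracLaplacian, ← VeryThin.fracConst]
    generalize VeryThin.fracConst (n - 1) (-a / 2) = C at hC ⊢
    field_simp
  · rw [hs]
    congr 1
    ring
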